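/- Let $R$ be an associative ring with unit; modules are left $R$-modules unless said otherwise, and complexes are chain complexes indexed by $\mathbb{Z}$. A module $F$ is flat if $-\otimes_R F$ preserves injections of right $R$-modules. A module $G$ is Gorenstein flat if there is an exact complex of flat modules $T=\cdots\to T_1\to T_0\to T_{-1}\to\cdots$ such that $I\otimes_R T$ is exact for every injective right $R$-module $I$ and $G\cong\ker(T_0\to T_{-1})$. The ring $R$ is left GF-closed if the class of Gorenstein flat modules is closed under extensions. The Gorenstein flat dimension $\mathrm{Gfd}_R M$ of a module $M$ is the least integer $n\ge 0$ for which there is an exact sequence $0\to G_n\to\cdots\to G_0\to M\to 0$ with all $G_i$ Gorenstein flat, and $\infty$ if there is no such $n$. A complex $F$ is DG-flat if each $F_n$ is flat and $E\otimes_R F$ is exact for every exact complex $E$ of right $R$-modules, where $(E\otimes_R F)_n=\bigoplus_{p+q=n}E_p\otimes_R F_q$ with differential $\partial(x\otimes y)=\partial x\otimes y+(-1)^p x\otimes\partial y$ for $x\in E_p$. A DG-flat resolution of a complex $N$ is a quasi-isomorphism $F\to N$ with $F$ DG-flat. Put $C_j(F)=\mathrm{coker}(F_{j+1}\to F_j)$.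 For $g\in\mathbb{Z}$, write $\mathrm{Gfd}\,N\le g$ if there is a DG-flat resolution $F\to N$ such that $H_j(F)=0$ for all $j>g$ and $C_j(F)$ is Gorenstein flat for all $j\ge g$. Then $\mathrm{Gfd}\,N\in\mathbb{Z}\cup\{-\infty,\infty\}$ is the least $g$ with $\mathrm{Gfd}\,N\le g$; it is $-\infty$ if $\mathrm{Gfd}\,N\le g$ for all $g$, and $\infty$ if this holds for no $g$. **Proposition.** Let $R$ be a left GF-closed ring, let $M$ be a nonzero $R$-module, and let $\overline{M}$ be the complex with $M$ in degree $0$ and $0$ in all other degrees. Then $\mathrm{Gfd}\,\overline{M}=\mathrm{Gfd}_R M$. -/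

import Mathlib

open CategoryTheory

universe u v

namespace GorensteinFlat

noncomputable section

/-! ### The tensor product over a noncommutative ring

Left `R`-modules are the objects of `ModuleCat R`, right `R`-modules those of
`ModuleCat Rᵐᵒᵖ`; the right action `x * r` is written `MulOpposite.op r • x`. -/

section Tensor

variable {R : Type u} [Ring R]

/-- The subgroup of `E ⊗[ℤ] F` generated by the elements `(x * r) ⊗ y - x ⊗ (r * y)`. -/
def balancedRel (R : Type u) [Ring R] (E F : Type v) [AddCommGroup E] [Module Rᵐᵒᵖ E]
    [AddCommGroup F] [Module R F] : Submodule ℤ (TensorProduct ℤ E F) :=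
  Submodule.span ℤ {t | ∃ (x : E) (r : R) (y : F),
    t = TensorProduct.tmul ℤ (MulOpposite.op r • x) y - TensorProduct.tmul ℤ x (r • y)}

/-- The abelian group `E ⊗_R F`, for a right `R`-module `E` and a left `R`-module `F`. -/
abbrev Tens (R : Type u) [Ring R] (E F : Type v) [AddCommGroup E] [Module Rᵐᵒᵖ E]
    [AddCommGroup F] [Module R F] : Type v :=
  TensorProduct ℤ E F ⧸ balancedRel R E F

lemma balancedRel_le_comap {E E' F F' : Type v} [AddCommGroup E] [Module Rᵐᵒᵖ E]
    [AddCommGroup E'] [Module Rᵐᵒᵖ E'] [AddCommGroup F] [Module R F]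
    [AddCommGroup F'] [Module R F'] (f : E →ₗ[Rᵐᵒᵖ] E') (g : F →ₗ[R] F') :
    balancedRel R E F ≤ (balancedRel R E' F').comap
      (TensorProduct.map f.toAddMonoidHom.toIntLinearMap g.toAddMonoidHom.toIntLinearMap) := by
  refine Submodule.span_le.2 ?_
  rintro _ ⟨x, r, y, rfl⟩
  refine Submodule.subset_span ⟨f x, r, g y, ?_⟩
  simp

/-- The map `f ⊗ g : E ⊗_R F → E' ⊗_R F'`. -/
def tensMap {E E' F F' : Type v} [AddCommGroup E] [Module Rᵐᵒᵖ E]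
    [AddCommGroup E'] [Module Rᵐᵒᵖ E'] [AddCommGroup F] [Module R F]
    [AddCommGroup F'] [Module R F'] (f : E →ₗ[Rᵐᵒᵖ] E') (g : F →ₗ[R] F') :
    Tens R E F →ₗ[ℤ] Tens R E' F' :=
  Submodule.mapQ _ _
    (TensorProduct.map f.toAddMonoidHom.toIntLinearMap g.toAddMonoidHom.toIntLinearMap)
    (balancedRel_le_comap f g)

lemma tensMap_mk_tmul {E E' F F' : Type v} [AddCommGroup E] [Module Rᵐᵒᵖ E]
    [AddCommGroup E'] [Module Rᵐᵒᵖ E'] [AddCommGroup F] [Module R F]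
    [AddCommGroup F'] [Module R F'] (f : E →ₗ[Rᵐᵒᵖ] E') (g : F →ₗ[R] F') (x : E) (y : F) :
    tensMap f g ((balancedRel R E F).mkQ (TensorProduct.tmul ℤ x y)) =
      (balancedRel R E' F').mkQ (TensorProduct.tmul ℤ (f x) (g y)) := rfl

lemma tens_hom_ext {E F : Type v} [AddCommGroup E] [Module Rᵐᵒᵖ E]
    [AddCommGroup F] [Module R F] {A : Type v} [AddCommGroup A] {a b : Tens R E F →ₗ[ℤ] A}
    (h : ∀ x y, a ((balancedRel R E F).mkQ (TensorProduct.tmul ℤ x y)) =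
      b ((balancedRel R E F).mkQ (TensorProduct.tmul ℤ x y))) : a = b := by
  refine Submodule.linearMap_qext _ (TensorProduct.ext' fun x y => ?_)
  exact h x y

end Tensor

variable (R : Type u) [Ring R]

/-- The bifunctor `(E, F) ↦ E ⊗_R F`. -/
def tensor : ModuleCat.{v} Rᵐᵒᵖ ⥤ ModuleCat.{v} R ⥤ ModuleCat.{v} ℤ where
  obj E :=
    { obj F := ModuleCat.of ℤ (Tens R E F)
      map g := ModuleCat.ofHom (tensMap LinearMap.id g.hom)
      map_id F := by
        ext1
        exact tens_hom_ext fun x y => rfl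
      map_comp f g := by
        ext1
        exact tens_hom_ext fun x y => rfl }
  map f :=
    { app F := ModuleCat.ofHom (tensMap f.hom LinearMap.id)
      naturality F F' g := by
        ext1
        exact tens_hom_ext fun x y => rfl }
  map_id E := by
    ext F : 3
    exact tens_hom_ext fun x y => rfl
  map_comp f g := by
    ext F : 3
    exact tens_hom_ext fun x y => rfl

instance : (tensor.{u, v} R).Additive where
  map_add {E E' f g} := by
    ext F : 3
    refine tens_hom_ext fun x y => ?_
    change (balancedRel R E' F).mkQ (TensorProduct.tmul ℤ (f.hom x + g.hom x) y) = _
    rw [TensorProduct.add_tmul, map_add]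
    rfl

instance (E : ModuleCat.{v} Rᵐᵒᵖ) : ((tensor.{u, v} R).obj E).Additive where
  map_add {F F' f g} := by
    ext1
    refine tens_hom_ext fun x y => ?_
    change (balancedRel R E F').mkQ (TensorProduct.tmul ℤ x (f.hom y + g.hom y)) = _
    rw [TensorProduct.tmul_add, map_add]
    rfl

/-- The signs of the tensor product of chain complexes indexed by `ℤ`: the differential is
`d (x ⊗ y) = d x ⊗ y + (-1) ^ p • (x ⊗ d y)` for `x` of degree `p`. -/
instance tensorSignsDownInt : (ComplexShape.down ℤ).TensorSigns where
  ε' := MonoidHom.mk' (fun i : Multiplicative ℤ => Int.negOnePow i.toAdd)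
    (fun a b => Int.negOnePow_add a.toAdd b.toAdd)
  rel_add p q r (hpq : q + 1 = p) := show q + r + 1 = p + r by omega
  add_rel p q r (hpq : q + 1 = p) := show r + q + 1 = r + p by omega
  ε'_succ p q (hpq : q + 1 = p) := by
    subst hpq
    change Int.negOnePow q = - Int.negOnePow (q + 1)
    rw [Int.negOnePow_succ, neg_neg]

variable {R}

/-- The tensor product `E ⊗_R F` of a complex of right modules and a complex of left modules:
in degree `n` it is `⨁_{p + q = n} E_p ⊗_R F_q`. -/
def tensorComplex (E : ChainComplex (ModuleCat.{v} Rᵐᵒᵖ) ℤ)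
    (F : ChainComplex (ModuleCat.{v} R) ℤ) : ChainComplex (ModuleCat.{v} ℤ) ℤ :=
  HomologicalComplex.mapBifunctor E F (tensor.{u, v} R) (ComplexShape.down ℤ)

/-- The complex `E ⊗_R T` for a right module `E` and a complex `T` of left modules. -/
def tensorModuleComplex (E : ModuleCat.{v} Rᵐᵒᵖ) (T : ChainComplex (ModuleCat.{v} R) ℤ) :
    ChainComplex (ModuleCat.{v} ℤ) ℤ :=
  (((tensor.{u, v} R).obj E).mapHomologicalComplex (ComplexShape.down ℤ)).obj T

/-! ### Flat and Gorenstein flat modules -/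

/-- A left `R`-module `F` is flat if `- ⊗_R F` preserves injections of right `R`-modules. -/
def IsFlat (F : ModuleCat.{v} R) : Prop :=
  ∀ ⦃E E' : ModuleCat.{v} Rᵐᵒᵖ⦄ (f : E ⟶ E'), Function.Injective f →
    Function.Injective (((tensor.{u, v} R).map f).app F)

/-- A left `R`-module `N` is Gorenstein flat if there is an exact complex `T` of flat modules
which stays exact under `I ⊗_R -` for every injective right `R`-module `I`, and such that
`N ≅ Ker (T_0 → T_{-1})`. -/
def IsGorensteinFlat (N : ModuleCat.{v} R) : Prop :=
  ∃ T : ChainComplex (ModuleCat.{v} R) ℤ,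
    (∀ n, IsFlat (T.X n)) ∧ T.Acyclic ∧
    (∀ I : ModuleCat.{v} Rᵐᵒᵖ, Injective I → (tensorModuleComplex I T).Acyclic) ∧
    Nonempty (N ≅ ModuleCat.of R (LinearMap.ker (T.d 0 (-1)).hom))

variable (R) in
/-- `R` is left GF-closed if the class of Gorenstein flat left `R`-modules is closed under
extensions. -/
def IsLeftGFClosed : Prop :=
  ∀ S : ShortComplex (ModuleCat.{v} R), S.ShortExact →
    IsGorensteinFlat S.X₁ → IsGorensteinFlat S.X₃ → IsGorensteinFlat S.X₂

/-- There is an exact sequence `0 → P_n → ⋯ → P_0 → M → 0` with each `P_i` Gorenstein flat. -/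
def HasGFResolution (M : ModuleCat.{v} R) (n : ℕ) : Prop :=
  ∃ (P : ChainComplex (ModuleCat.{v} R) ℕ) (π : P.X 0 ⟶ M),
    (∀ i ≤ n, IsGorensteinFlat (P.X i)) ∧ (∀ i > n, Subsingleton (P.X i)) ∧
    Function.Surjective π ∧ Function.Exact (P.d 1 0) π ∧
    ∀ i, Function.Exact (P.d (i + 2) (i + 1)) (P.d (i + 1) i)

/-- The Gorenstein flat dimension of a module: the least `n` such that there is a Gorenstein
flat resolution of length `n`, and `⊤` (that is, `∞`) if there is none. -/
def moduleGfd (M : ModuleCat.{v} R) : WithBot (WithTop ℤ) :=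
  sInf {d | ∃ n : ℕ, HasGFResolution M n ∧ d = (((n : ℤ) : WithTop ℤ) : WithBot (WithTop ℤ))}

/-! ### The Gorenstein flat dimension of an unbounded complex -/

/-- A complex `F` of left modules is DG-flat if each `F_n` is flat and `E ⊗_R F` is exact for
every exact complex `E` of right modules. -/
def IsDGFlat (F : ChainComplex (ModuleCat.{v} R) ℤ) : Prop :=
  (∀ n, IsFlat (F.X n)) ∧
    ∀ E : ChainComplex (ModuleCat.{v} Rᵐᵒᵖ) ℤ, E.Acyclic → (tensorComplex E F).Acyclic

/-- `C_j(F)`, the cokernel of `F_{j+1} → F_j`. -/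
def coker (F : ChainComplex (ModuleCat.{v} R) ℤ) (j : ℤ) : ModuleCat.{v} R :=
  ModuleCat.of R (F.X j ⧸ LinearMap.range (F.d (j + 1) j).hom)

/-- `Gfd N ≤ g`: there is a DG-flat resolution `F → N` such that `H_j(F) = 0` for `j > g`
and `C_j(F)` is Gorenstein flat for `j ≥ g`. -/
def ComplexGfdLE (N : ChainComplex (ModuleCat.{v} R) ℤ) (g : ℤ) : Prop :=
  ∃ (F : ChainComplex (ModuleCat.{v} R) ℤ) (φ : F ⟶ N),
    IsDGFlat F ∧ QuasiIso φ ∧ (∀ j > g, F.ExactAt j) ∧ ∀ j ≥ g, IsGorensteinFlat (coker F j)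

/-- The Gorenstein flat dimension of a complex, in `ℤ ∪ {-∞, ∞}`: the least `g` with
`Gfd N ≤ g`; it is `⊥` if `Gfd N ≤ g` for all `g`, and `⊤` if this holds for no `g`. -/
def complexGfd (N : ChainComplex (ModuleCat.{v} R) ℤ) : WithBot (WithTop ℤ) :=
  sInf {d | ∃ g : ℤ, ComplexGfdLE N g ∧ d = ((g : WithTop ℤ) : WithBot (WithTop ℤ))}

/-- The module `M` as a complex concentrated in degree `0`. -/
def inDegreeZero (M : ModuleCat.{v} R) : ChainComplex (ModuleCat.{v} R) ℤ :=
  (HomologicalComplex.single (ModuleCat.{v} R) (ComplexShape.down ℤ) 0).obj M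

end

end GorensteinFlat

/-! Both dimensions are infima, so it suffices that the same numbers occur: `ComplexGfdLE
(inDegreeZero M) g` holds exactly when `g` is a natural number `n` with `GFDimLE n M`.

From complexes to modules, let `F → M` be a DG-flat resolution witnessing the bound `g`. Since
`H_0(F) ≅ M ≠ 0`, we have `g = n ≥ 0`. As `F` is exact in positive degrees, the sequences `0 →
C_{j+1} → F_j → C_j → 0` for `0 ≤ j < n` show that `C_0` has dimension at most `n`. The module
itself sits in `0 → M → C_0 → B → 0` with `B` the image of `F_0 → F_{-1}`. The delicate point is
that `B` is flat (`IsDGFlat.isFlat_range`): tensoring `F` with an augmented projective resolution of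
a right module `E` shows that `E ⊗ F` is exact in negative degrees. Then `GFDimLE.ker` passes the
bound from `C_0` to `M`.

From modules to complexes, take a projective resolution. It is DG-flat because it is bounded below
and flat (`isDGFlat_of_bounded`), its `C_0` is `M`, and each further syzygy lowers the dimension by
one (`GFDimLE.syzygy`), so `C_j` is Gorenstein flat for `j ≥ n`.

Both directions rest on `IsLeftGFClosed.ker`: over a left GF-closed ring, kernels of surjections
between Gorenstein flat modules are Gorenstein flat. If `K` is the kernel of `B → C`, embed `B` in a
flat `T` with Gorenstein flat cokernel `N`; then `T/K` is an extension of `N` by `C`, hence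
Gorenstein flat, and `K` is the kernel of `T → T/K`. This last case, with flat middle term, needs no
closure hypothesis and is `IsGorensteinFlat.ker_of_flat`. -/

namespace GorensteinFlat

noncomputable section

/-! ### Exactness properties of the tensor product over a noncommutative ring. -/

section TensorExactness

variable {R : Type u} [Ring R]

/-- The element `x ⊗ y` of `E ⊗_R F`. -/
abbrev tens {E F : Type v} [AddCommGroup E] [Module Rᵐᵒᵖ E] [AddCommGroup F] [Module R F]
    (x : E) (y : F) : Tens R E F :=
  (balancedRel R E F).mkQ (TensorProduct.tmul ℤ x y)

variable {E E' E'' : Type v} [AddCommGroup E] [Module Rᵐᵒᵖ E] [AddCommGroup E'] [Module Rᵐᵒᵖ E']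
  [AddCommGroup E''] [Module Rᵐᵒᵖ E'']
  {F F' F'' : Type v} [AddCommGroup F] [Module R F] [AddCommGroup F'] [Module R F']
  [AddCommGroup F''] [Module R F'']

lemma tens_smul (x : E) (r : R) (y : F) :
    tens (R := R) (MulOpposite.op r • x) y = tens x (r • y) :=
  (Submodule.Quotient.eq _).2 (Submodule.subset_span ⟨x, r, y, rfl⟩)

lemma tens_induction {p : Tens R E F → Prop} (h : ∀ x y, p (tens x y)) (hzero : p 0)
    (hadd : ∀ a b, p a → p b → p (a + b)) (t : Tens R E F) : p t := by
  obtain ⟨t, rfl⟩ := Submodule.mkQ_surjective _ t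
  induction t with
  | zero => simpa using hzero
  | tmul x y => exact h x y
  | add a b ha hb => rw [map_add]; exact hadd _ _ ha hb

lemma tensMap_comp (f : E →ₗ[Rᵐᵒᵖ] E') (f' : E' →ₗ[Rᵐᵒᵖ] E'') (g : F →ₗ[R] F')
    (g' : F' →ₗ[R] F'') (t : Tens R E F) :
    tensMap f' g' (tensMap f g t) = tensMap (f' ∘ₗ f) (g' ∘ₗ g) t := by
  induction t using tens_induction with
  | h x y => rfl
  | hzero => simp
  | hadd a b ha hb => simp only [map_add, ha, hb]

lemma tensMap_id (t : Tens R E F) :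
    tensMap (LinearMap.id (R := Rᵐᵒᵖ)) (LinearMap.id (R := R)) t = t := by
  induction t using tens_induction with
  | h x y => rfl
  | hzero => simp
  | hadd a b ha hb => simp only [map_add, ha, hb]

lemma tensMap_comm (f : E →ₗ[Rᵐᵒᵖ] E') (g : F →ₗ[R] F') (t : Tens R E F) :
    tensMap f LinearMap.id (tensMap LinearMap.id g t) =
      tensMap LinearMap.id g (tensMap f LinearMap.id t) := by
  rw [tensMap_comp, tensMap_comp]; rfl

lemma tensMap_zero_right (f : E →ₗ[Rᵐᵒᵖ] E') (t : Tens R E F) :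
    tensMap f (0 : F →ₗ[R] F') t = 0 := by
  induction t using tens_induction with
  | h x y => rw [tensMap_mk_tmul]; simp
  | hzero => simp
  | hadd a b ha hb => simp only [map_add, ha, hb, add_zero]

lemma tensMap_zero_left (g : F →ₗ[R] F') (t : Tens R E F) :
    tensMap (0 : E →ₗ[Rᵐᵒᵖ] E') g t = 0 := by
  induction t using tens_induction with
  | h x y => rw [tensMap_mk_tmul]; simp
  | hzero => simp
  | hadd a b ha hb => simp only [map_add, ha, hb, add_zero]

lemma tensMap_surjective {f : E →ₗ[Rᵐᵒᵖ] E'} {g : F →ₗ[R] F'} (hf : Function.Surjective f)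
    (hg : Function.Surjective g) : Function.Surjective (tensMap f g) := by
  intro t
  induction t using tens_induction with
  | h x y =>
    obtain ⟨x, rfl⟩ := hf x
    obtain ⟨y, rfl⟩ := hg y
    exact ⟨tens x y, rfl⟩
  | hzero => exact ⟨0, map_zero _⟩
  | hadd a b ha hb =>
    obtain ⟨a, rfl⟩ := ha
    obtain ⟨b, rfl⟩ := hb
    exact ⟨a + b, map_add _ _ _⟩

/-- Each generating relation lifts along surjections. This is what transfers right exactness from
the tensor product over `ℤ` to the one over `R`. -/
lemma balancedRel_le_map {f : E →ₗ[Rᵐᵒᵖ] E'} {g : F →ₗ[R] F'} (hf : Function.Surjective f)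
    (hg : Function.Surjective g) :
    balancedRel R E' F' ≤ (balancedRel R E F).map
      (TensorProduct.map f.toAddMonoidHom.toIntLinearMap g.toAddMonoidHom.toIntLinearMap) := by
  refine Submodule.span_le.2 ?_
  rintro _ ⟨x, r, y, rfl⟩
  obtain ⟨x, rfl⟩ := hf x
  obtain ⟨y, rfl⟩ := hg y
  exact ⟨_, Submodule.subset_span ⟨x, r, y, rfl⟩, by simp⟩

/-- `E ⊗_R -` is right exact. -/
lemma tensMap_exact_right {g : F →ₗ[R] F'} {g' : F' →ₗ[R] F''} (h : Function.Exact g g')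
    (hg' : Function.Surjective g') :
    Function.Exact (tensMap (LinearMap.id (R := Rᵐᵒᵖ) (M := E)) g)
      (tensMap (LinearMap.id (R := Rᵐᵒᵖ) (M := E)) g') := by
  intro t
  constructor
  · intro ht
    obtain ⟨t, rfl⟩ := Submodule.mkQ_surjective _ t
    have hid : Function.Surjective (LinearMap.id (R := Rᵐᵒᵖ) (M := E)) := Function.surjective_id
    -- The image of `t` over `ℤ` is only a relation, not zero. Subtracting a lift `r` of that
    -- relation gives an element to which exactness over `ℤ` applies.
    obtain ⟨r, hr, hrt⟩ := balancedRel_le_map hid hg' ((Submodule.Quotient.mk_eq_zero _).1 ht)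
    have hex := lTensor_exact (R := ℤ) E (f := g.toAddMonoidHom.toIntLinearMap)
      (g := g'.toAddMonoidHom.toIntLinearMap) h hg'
    obtain ⟨s, hs⟩ := (hex (t - r)).1 (by
      rw [map_sub, sub_eq_zero]; exact hrt.symm)
    refine ⟨(balancedRel R E F).mkQ s, (Submodule.Quotient.eq _).2 ?_⟩
    change LinearMap.lTensor E g.toAddMonoidHom.toIntLinearMap s - t ∈ _
    rw [hs, sub_sub_cancel_left]
    exact neg_mem hr
  · rintro ⟨s, rfl⟩
    rw [tensMap_comp, h.linearMap_comp_eq_zero, tensMap_zero_right]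

/-- `- ⊗_R F` is right exact. -/
lemma tensMap_exact_left {f : E →ₗ[Rᵐᵒᵖ] E'} {f' : E' →ₗ[Rᵐᵒᵖ] E''} (h : Function.Exact f f')
    (hf' : Function.Surjective f') :
    Function.Exact (tensMap f (LinearMap.id (R := R) (M := F)))
      (tensMap f' (LinearMap.id (R := R) (M := F))) := by
  intro t
  constructor
  · intro ht
    obtain ⟨t, rfl⟩ := Submodule.mkQ_surjective _ t
    have hid : Function.Surjective (LinearMap.id (R := R) (M := F)) := Function.surjective_id
    obtain ⟨r, hr, hrt⟩ := balancedRel_le_map hf' hid ((Submodule.Quotient.mk_eq_zero _).1 ht)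
    have hex := rTensor_exact (R := ℤ) F (f := f.toAddMonoidHom.toIntLinearMap)
      (g := f'.toAddMonoidHom.toIntLinearMap) h hf'
    obtain ⟨s, hs⟩ := (hex (t - r)).1 (by
      rw [map_sub, sub_eq_zero]; exact hrt.symm)
    refine ⟨(balancedRel R E F).mkQ s, (Submodule.Quotient.eq _).2 ?_⟩
    change LinearMap.rTensor F f.toAddMonoidHom.toIntLinearMap s - t ∈ _
    rw [hs, sub_sub_cancel_left]
    exact neg_mem hr
  · rintro ⟨s, rfl⟩
    rw [tensMap_comp, h.linearMap_comp_eq_zero, tensMap_zero_left]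

/-- A section `s` of the canonical surjection from the free module on the set `E` makes `E ⊗ G` a
retract of `E →₀ G`, compatibly with maps in `G`; on finitely supported functions `g` acts
pointwise, so injectivity is clear. -/
lemma tensMap_injective_of_projective_left [Module.Projective Rᵐᵒᵖ E] {g : F →ₗ[R] F'}
    (hg : Function.Injective g) :
    Function.Injective (tensMap (LinearMap.id (R := Rᵐᵒᵖ) (M := E)) g) := by
  obtain ⟨s, hs⟩ := (Module.projective_def (R := Rᵐᵒᵖ) (P := E)).1 inferInstance
  have key : ∀ (G : Type v) [AddCommGroup G] [Module R G], ∃ φ : Tens R E G →ₗ[ℤ] (E →₀ G),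
      (∀ x y, φ (tens x y) = (s x).mapRange (fun r => r.unop • y) (zero_smul R y)) ∧
      Function.Injective φ := by
    intro G _ _
    let φ₀ : E →+ G →+ (E →₀ G) := AddMonoidHom.mk' (fun x => AddMonoidHom.mk'
        (fun y => (s x).mapRange (fun r => r.unop • y) (zero_smul R y))
        (fun a b => by ext; simp [smul_add])) (fun a b => by ext; simp [add_smul])
    let φ₁ : TensorProduct ℤ E G →ₗ[ℤ] (E →₀ G) := TensorProduct.lift
      { toFun := fun x => (φ₀ x).toIntLinearMap
        map_add' := fun a b => by ext; simp
        map_smul' := fun n a => by ext; simp }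
    have hφ₁ : ∀ x y, φ₁ (TensorProduct.tmul ℤ x y) =
      (s x).mapRange (fun r => r.unop • y) (zero_smul R y) := fun x y => rfl
    let φ : Tens R E G →ₗ[ℤ] (E →₀ G) := Submodule.liftQ _ φ₁ (by
      refine Submodule.span_le.2 ?_
      rintro _ ⟨x, r, y, rfl⟩
      simp only [SetLike.mem_coe, LinearMap.mem_ker, map_sub, hφ₁, sub_eq_zero]
      ext; simp [mul_smul])
    have hφ : ∀ x y, φ (tens x y) = (s x).mapRange (fun r => r.unop • y) (zero_smul R y) :=
      fun x y => rfl
    let ψ : (E →₀ G) →+ Tens R E G := Finsupp.liftAddHom fun x =>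
      AddMonoidHom.mk' (fun y => tens x y) (fun a b => by
        rw [tens, TensorProduct.tmul_add, map_add])
    refine ⟨φ, hφ, Function.LeftInverse.injective (g := ψ) fun t => ?_⟩
    induction t using tens_induction with
    | hzero => simp
    | hadd a b ha hb => rw [map_add, map_add, ha, hb]
    | h x y =>
      have : ∀ f : E →₀ Rᵐᵒᵖ, ψ (f.mapRange (fun r => r.unop • y) (zero_smul R y)) =
          tens (Finsupp.linearCombination Rᵐᵒᵖ id f) y := by
        intro f
        induction f using Finsupp.induction_linear with
        | zero => simp [tens]
        | add f g hf hg =>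
          rw [Finsupp.mapRange_add (fun a b => by simp [add_smul]), map_add, hf, hg, map_add,
            tens, tens, tens, TensorProduct.add_tmul, map_add]
        | single a r =>
          simp only [Finsupp.mapRange_single, Finsupp.linearCombination_single, id]
          rw [← MulOpposite.op_unop r, tens_smul]
          simp [ψ]
      rw [hφ, this, hs]
  obtain ⟨φ, hφ, hφi⟩ := key F
  obtain ⟨φ', hφ', hφi'⟩ := key F'
  have hcomm : ∀ t, φ' (tensMap LinearMap.id g t) =
      (φ t).mapRange g (map_zero g) := by
    intro t
    induction t using tens_induction with
    | hzero => simp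
    | hadd a b ha hb =>
      rw [map_add, map_add, ha, hb, map_add, Finsupp.mapRange_add (map_add g)]
    | h x y =>
      rw [tensMap_mk_tmul]
      change φ' (tens x (g y)) = _
      rw [hφ, hφ']
      ext; simp
  intro a b hab
  apply hφi
  apply Finsupp.mapRange_injective g (map_zero g) hg
  rw [← hcomm, ← hcomm, hab]

lemma tensMap_injective_of_projective_right [Module.Projective R F] {f : E →ₗ[Rᵐᵒᵖ] E'}
    (hf : Function.Injective f) :
    Function.Injective (tensMap f (LinearMap.id (R := R) (M := F))) := by
  obtain ⟨s, hs⟩ := (Module.projective_def (R := R) (P := F)).1 inferInstance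
  have key : ∀ (G : Type v) [AddCommGroup G] [Module Rᵐᵒᵖ G], ∃ φ : Tens R G F →ₗ[ℤ] (F →₀ G),
      (∀ x y, φ (tens x y) = (s y).mapRange (fun r => MulOpposite.op r • x)
        (by simp)) ∧
      Function.Injective φ := by
    intro G _ _
    let φ₀ : G →+ F →+ (F →₀ G) := AddMonoidHom.mk' (fun x => AddMonoidHom.mk'
        (fun y => (s y).mapRange (fun r => MulOpposite.op r • x) (by simp))
        (fun a b => by ext; simp [add_smul])) (fun a b => by ext; simp [smul_add])
    let φ₁ : TensorProduct ℤ G F →ₗ[ℤ] (F →₀ G) := TensorProduct.lift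
      { toFun := fun x => (φ₀ x).toIntLinearMap
        map_add' := fun a b => by ext; simp
        map_smul' := fun n a => by ext; simp }
    have hφ₁ : ∀ x y, φ₁ (TensorProduct.tmul ℤ x y) =
      (s y).mapRange (fun r => MulOpposite.op r • x) (by simp) := fun x y => rfl
    let φ : Tens R G F →ₗ[ℤ] (F →₀ G) := Submodule.liftQ _ φ₁ (by
      refine Submodule.span_le.2 ?_
      rintro _ ⟨x, r, y, rfl⟩
      simp only [SetLike.mem_coe, LinearMap.mem_ker, map_sub, hφ₁, sub_eq_zero]
      ext; simp [mul_smul])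
    have hφ : ∀ x y, φ (tens x y) = (s y).mapRange (fun r => MulOpposite.op r • x) (by simp) :=
      fun x y => rfl
    let ψ : (F →₀ G) →+ Tens R G F := Finsupp.liftAddHom fun y =>
      AddMonoidHom.mk' (fun x => tens x y) (fun a b => by
        rw [tens, TensorProduct.add_tmul, map_add])
    refine ⟨φ, hφ, Function.LeftInverse.injective (g := ψ) fun t => ?_⟩
    induction t using tens_induction with
    | hzero => simp
    | hadd a b ha hb => rw [map_add, map_add, ha, hb]
    | h x y =>
      have : ∀ f : F →₀ R, ψ (f.mapRange (fun r => MulOpposite.op r • x) (by simp)) =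
          tens x (Finsupp.linearCombination R id f) := by
        intro f
        induction f using Finsupp.induction_linear with
        | zero => simp [tens]
        | add f g hf hg =>
          rw [Finsupp.mapRange_add (fun a b => by simp [add_smul]), map_add, hf, hg, map_add,
            tens, tens, tens, TensorProduct.tmul_add, map_add]
        | single a r =>
          simp only [Finsupp.mapRange_single, Finsupp.linearCombination_single, id]
          rw [← tens_smul]
          simp [ψ]
      rw [hφ, this, hs]
  obtain ⟨φ, hφ, hφi⟩ := key E
  obtain ⟨φ', hφ', hφi'⟩ := key E'
  have hcomm : ∀ t, φ' (tensMap f LinearMap.id t) =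
      (φ t).mapRange f (map_zero f) := by
    intro t
    induction t using tens_induction with
    | hzero => simp
    | hadd a b ha hb =>
      rw [map_add, map_add, ha, hb, map_add, Finsupp.mapRange_add (map_add f)]
    | h x y =>
      rw [tensMap_mk_tmul]
      change φ' (tens (f x) y) = _
      rw [hφ, hφ']
      ext; simp
  intro a b hab
  apply hφi
  apply Finsupp.mapRange_injective f (map_zero f) hf
  rw [← hcomm, ← hcomm, hab]

/-- If `E ⊗_R -` preserves injections, then it preserves exactness. -/
lemma tensMap_exact_of_injective_right
    (hE : ∀ ⦃G G' : Type v⦄ [AddCommGroup G] [Module R G] [AddCommGroup G'] [Module R G']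
      (g : G →ₗ[R] G'), Function.Injective g →
        Function.Injective (tensMap (LinearMap.id (R := Rᵐᵒᵖ) (M := E)) g))
    {g : F →ₗ[R] F'} {g' : F' →ₗ[R] F''} (h : Function.Exact g g') :
    Function.Exact (tensMap (LinearMap.id (R := Rᵐᵒᵖ) (M := E)) g)
      (tensMap (LinearMap.id (R := Rᵐᵒᵖ) (M := E)) g') := by
  -- Factor `g'` through its image: right exactness handles the surjection, the hypothesis `hE` the
  -- inclusion.
  have h1 : Function.Exact g g'.rangeRestrict := fun x => by
    rw [← h x, ← Subtype.coe_inj]; rfl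
  have h2 := tensMap_exact_right (E := E) h1 g'.surjective_rangeRestrict
  intro t
  rw [← h2 t]
  have : tensMap (LinearMap.id (R := Rᵐᵒᵖ) (M := E)) g' t =
      tensMap LinearMap.id (LinearMap.range g').subtype
        (tensMap LinearMap.id g'.rangeRestrict t) := by
    rw [tensMap_comp]; rfl
  rw [this, map_eq_zero_iff _ (hE _ (Submodule.injective_subtype _))]

/-- If `- ⊗_R F` preserves injections, then it preserves exactness. -/
lemma tensMap_exact_of_injective_left
    (hF : ∀ ⦃G G' : Type v⦄ [AddCommGroup G] [Module Rᵐᵒᵖ G] [AddCommGroup G'] [Module Rᵐᵒᵖ G']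
      (f : G →ₗ[Rᵐᵒᵖ] G'), Function.Injective f →
        Function.Injective (tensMap f (LinearMap.id (R := R) (M := F))))
    {f : E →ₗ[Rᵐᵒᵖ] E'} {f' : E' →ₗ[Rᵐᵒᵖ] E''} (h : Function.Exact f f') :
    Function.Exact (tensMap f (LinearMap.id (R := R) (M := F)))
      (tensMap f' (LinearMap.id (R := R) (M := F))) := by
  have h1 : Function.Exact f f'.rangeRestrict := fun x => by
    rw [← h x, ← Subtype.coe_inj]; rfl
  have h2 := tensMap_exact_left (F := F) h1 f'.surjective_rangeRestrict
  intro t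
  rw [← h2 t]
  have : tensMap f' (LinearMap.id (R := R) (M := F)) t =
      tensMap (LinearMap.range f').subtype LinearMap.id
        (tensMap f'.rangeRestrict LinearMap.id t) := by
    rw [tensMap_comp]; rfl
  rw [this, map_eq_zero_iff _ (hF _ (Submodule.injective_subtype _))]

lemma isFlat_iff (F : ModuleCat.{v} R) : IsFlat F ↔
    ∀ ⦃G G' : Type v⦄ [AddCommGroup G] [Module Rᵐᵒᵖ G] [AddCommGroup G'] [Module Rᵐᵒᵖ G']
      (f : G →ₗ[Rᵐᵒᵖ] G'), Function.Injective f →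
        Function.Injective (tensMap f (LinearMap.id (R := R) (M := F))) := by
  constructor
  · intro h G G' _ _ _ _ f hf
    exact h (ModuleCat.ofHom f) hf
  · intro h E E' f hf
    exact h f.hom hf

lemma IsFlat.tensMap_exact {F : ModuleCat.{v} R} (hF : IsFlat F)
    {f : E →ₗ[Rᵐᵒᵖ] E'} {f' : E' →ₗ[Rᵐᵒᵖ] E''} (h : Function.Exact f f') :
    Function.Exact (tensMap f (LinearMap.id (R := R) (M := F)))
      (tensMap f' (LinearMap.id (R := R) (M := F))) :=
  tensMap_exact_of_injective_left ((isFlat_iff F).1 hF) h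

lemma tensMap_exact_of_projective [Module.Projective Rᵐᵒᵖ E]
    {g : F →ₗ[R] F'} {g' : F' →ₗ[R] F''} (h : Function.Exact g g') :
    Function.Exact (tensMap (LinearMap.id (R := Rᵐᵒᵖ) (M := E)) g)
      (tensMap (LinearMap.id (R := Rᵐᵒᵖ) (M := E)) g') :=
  tensMap_exact_of_injective_right (fun _ _ _ _ _ _ _ => tensMap_injective_of_projective_left) h

lemma isFlat_of_projective (F : ModuleCat.{v} R) [Module.Projective R F] : IsFlat F :=
  fun _ _ _ hf => tensMap_injective_of_projective_right hf

lemma isFlat_of_subsingleton (F : ModuleCat.{v} R) [Subsingleton F] : IsFlat F :=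
  isFlat_of_projective F

end TensorExactness

/-! ### Short exact sequences, pullbacks and enough projectives. -/

section ShortExactSequences

variable {R : Type u} [Ring R]

/-- `0 → A → B → C → 0` is exact. -/
structure SES {A B C : ModuleCat.{v} R} (f : A →ₗ[R] B) (g : B →ₗ[R] C) : Prop where
  inj : Function.Injective f
  exact : Function.Exact f g
  surj : Function.Surjective g

variable {A A' B B' C : ModuleCat.{v} R}

lemma SES.ker_subtype {g : B →ₗ[R] C} (hg : Function.Surjective g) :
    SES (A := ModuleCat.of R (LinearMap.ker g)) (LinearMap.ker g).subtype g :=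
  ⟨Submodule.injective_subtype _, LinearMap.exact_subtype_ker_map g, hg⟩

lemma SES.mkQ (p : Submodule R B) :
    SES (A := ModuleCat.of R p) (C := ModuleCat.of R (B ⧸ p)) p.subtype p.mkQ :=
  ⟨Submodule.injective_subtype _, LinearMap.exact_subtype_mkQ p, Submodule.mkQ_surjective p⟩

lemma SES.equiv_left {f : A →ₗ[R] B} {g : B →ₗ[R] C} (h : SES f g) (e : A' ≃ₗ[R] A) :
    SES (f ∘ₗ e.toLinearMap) g := by
  refine ⟨h.inj.comp e.injective, fun x => ?_, h.surj⟩
  rw [h.exact x, LinearMap.coe_comp]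
  simp

lemma SES.equiv_right {f : A →ₗ[R] B} {g : B →ₗ[R] C} (h : SES f g) {C' : ModuleCat.{v} R}
    (e : C ≃ₗ[R] C') : SES f (e.toLinearMap ∘ₗ g) := by
  refine ⟨h.inj, fun x => ?_, e.surjective.comp h.surj⟩
  rw [← h.exact x]
  simp

lemma SES.exists_equiv_ker {f : A →ₗ[R] B} {g : B →ₗ[R] C} (h : SES f g) :
    ∃ e : A ≃ₗ[R] LinearMap.ker g, ∀ a, (e a : B) = f a :=
  ⟨(LinearEquiv.ofInjective f h.inj).trans
    (LinearEquiv.ofEq _ _ h.exact.linearMap_ker_eq.symm), fun _ => rfl⟩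

/-- The pullback of two short exact sequences with the same right end. -/
lemma SES.pullback {f : A →ₗ[R] B} {g : B →ₗ[R] C} {f' : A' →ₗ[R] B'} {g' : B' →ₗ[R] C}
    (h : SES f g) (h' : SES f' g') :
    ∃ (X : ModuleCat.{v} R) (i : A →ₗ[R] X) (p : X →ₗ[R] B') (i' : A' →ₗ[R] X) (p' : X →ₗ[R] B),
      SES i p ∧ SES i' p' ∧ (∀ a, p' (i a) = f a) ∧ (∀ a, p (i' a) = f' a) ∧
      ∀ x, g (p' x) = g' (p x) := by
  let X : Submodule R (B × B') :=
    LinearMap.ker (g ∘ₗ LinearMap.fst R B B' - g' ∘ₗ LinearMap.snd R B B')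
  have hX : ∀ {x}, x ∈ X ↔ g x.1 = g' x.2 := by
    intro x; simp [X, sub_eq_zero]
  refine ⟨ModuleCat.of R X,
    LinearMap.codRestrict X (LinearMap.inl R B B' ∘ₗ f) (fun a => by
      simp [hX, h.exact.apply_apply_eq_zero]),
    LinearMap.snd R B B' ∘ₗ X.subtype,
    LinearMap.codRestrict X (LinearMap.inr R B B' ∘ₗ f') (fun a => by
      simp [hX, h'.exact.apply_apply_eq_zero]),
    LinearMap.fst R B B' ∘ₗ X.subtype, ⟨?_, ?_, ?_⟩, ⟨?_, ?_, ?_⟩, fun a => rfl, fun a => rfl,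
    fun x => hX.1 x.2⟩
  · intro a b hab
    exact h.inj (congrArg (fun x : X => x.1.1) hab)
  · rintro ⟨⟨b, b'⟩, hx⟩
    constructor
    · intro hb
      obtain rfl : b' = 0 := hb
      obtain ⟨a, rfl⟩ := (h.exact b).1 (by simpa using hX.1 hx)
      exact ⟨a, rfl⟩
    · rintro ⟨a, ha⟩
      exact (congrArg (fun x : X => x.1.2) ha).symm
  · intro b'
    obtain ⟨b, hb⟩ := h.surj (g' b')
    exact ⟨⟨(b, b'), hX.2 hb⟩, rfl⟩
  · intro a b hab
    exact h'.inj (congrArg (fun x : X => x.1.2) hab)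
  · rintro ⟨⟨b, b'⟩, hx⟩
    constructor
    · intro hb
      obtain rfl : b = 0 := hb
      obtain ⟨a, rfl⟩ := (h'.exact b').1 (by simpa using (hX.1 hx).symm)
      exact ⟨a, rfl⟩
    · rintro ⟨a, ha⟩
      exact (congrArg (fun x : X => x.1.1) ha).symm
  · intro b
    obtain ⟨b', hb⟩ := h'.surj (g b)
    exact ⟨⟨(b, b'), hX.2 hb.symm⟩, rfl⟩

lemma exists_projective_surjective {S : Type u} [Ring S] [Small.{v} S] (E : ModuleCat.{v} S) :
    ∃ (Q : ModuleCat.{v} S) (_ : Module.Projective S Q) (q : Q →ₗ[S] E), Function.Surjective q :=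
  ⟨Projective.over E, inferInstance, (Projective.π E).hom,
    (ModuleCat.epi_iff_surjective _).1 inferInstance⟩

instance small_mulOpposite [Small.{v} R] : Small.{v} Rᵐᵒᵖ :=
  small_map MulOpposite.opEquiv.symm

/-- If `K` is the kernel of `B → X` and `P` that of the composite `B → X → C`, then
`0 → K → P → Ker (X → C) → 0` is exact. -/
lemma SES.comp_ker {K X P : ModuleCat.{v} R} {f : A →ₗ[R] X} {g : X →ₗ[R] C} (h : SES f g)
    {k : K →ₗ[R] B} {b : B →ₗ[R] X} (hb : SES k b) {i : P →ₗ[R] B} (hi : SES i (g ∘ₗ b)) :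
    ∃ (j : K →ₗ[R] P) (q : P →ₗ[R] A), SES j q ∧ (∀ x, i (j x) = k x) ∧
      ∀ x, f (q x) = b (i x) := by
  obtain ⟨e, he⟩ := hi.exists_equiv_ker
  obtain ⟨e', he'⟩ := h.exists_equiv_ker
  let j : K →ₗ[R] P := e.symm.toLinearMap ∘ₗ LinearMap.codRestrict _ k (fun x => by
    simp [hb.exact.apply_apply_eq_zero])
  let q : P →ₗ[R] A := e'.symm.toLinearMap ∘ₗ LinearMap.codRestrict _ (b ∘ₗ i) (fun x => by
    simpa using hi.exact.apply_apply_eq_zero x)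
  have hj : ∀ x, i (j x) = k x := fun x => by rw [← he]; simp [j]
  have hq : ∀ x, f (q x) = b (i x) := fun x => by rw [← he']; simp [q]
  refine ⟨j, q, ⟨?_, ?_, ?_⟩, hj, hq⟩
  · intro x y hxy
    apply hb.inj
    rw [← hj, ← hj, hxy]
  · intro x
    rw [← h.inj.eq_iff, hq, map_zero, hb.exact (i x)]
    simp only [Set.mem_range, ← hj, hi.inj.eq_iff]
  · intro a
    obtain ⟨y, hy⟩ := hb.surj (f a)
    obtain ⟨x, rfl⟩ := (hi.exact y).1 (by simp [hy, h.exact.apply_apply_eq_zero])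
    exact ⟨x, h.inj (by rw [hq, hy])⟩

end ShortExactSequences

/-! ### Vanishing of Tor without derived functors. -/

section Tor

variable {R : Type u} [Ring R]

/-- `E ⊗_R A → E ⊗_R B` is injective. -/
def TensorInjective (E : ModuleCat.{v} Rᵐᵒᵖ) {A B : ModuleCat.{v} R} (f : A →ₗ[R] B) : Prop :=
  Function.Injective (tensMap (LinearMap.id (R := Rᵐᵒᵖ) (M := E)) f)

/-- `Tor_1(E, C) = 0`, expressed by saying that every short exact sequence ending in `C` stays
exact under `E ⊗_R -`. -/
def TorOneZero (E : ModuleCat.{v} Rᵐᵒᵖ) (C : ModuleCat.{v} R) : Prop :=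
  ∀ ⦃A B : ModuleCat.{v} R⦄ (f : A →ₗ[R] B) (g : B →ₗ[R] C), SES f g → TensorInjective E f

variable {E : ModuleCat.{v} Rᵐᵒᵖ} {A B C : ModuleCat.{v} R}

lemma tensMap_id_comp {f : A →ₗ[R] B} {g : B →ₗ[R] C} (t : Tens R E A) :
    tensMap (LinearMap.id (R := Rᵐᵒᵖ) (M := E)) g (tensMap LinearMap.id f t) =
      tensMap LinearMap.id (g ∘ₗ f) t := by
  rw [tensMap_comp]; rfl

lemma TensorInjective.comp {f : A →ₗ[R] B} {g : B →ₗ[R] C} (hg : TensorInjective E g)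
    (hf : TensorInjective E f) : TensorInjective E (g ∘ₗ f) := by
  intro a b hab
  rw [← tensMap_id_comp, ← tensMap_id_comp] at hab
  exact hf (hg hab)

lemma TensorInjective.of_comp {f : A →ₗ[R] B} {g : B →ₗ[R] C}
    (h : TensorInjective E (g ∘ₗ f)) : TensorInjective E f := by
  intro a b hab
  apply h
  rw [← tensMap_id_comp, ← tensMap_id_comp, hab]

/-- This is the balance of Tor, by a diagram chase. Present `E` as `Q/L` with `Q` projective: `L ⊗ C
→ Q ⊗ C` is injective because `C` is flat, and `Q ⊗ A → Q ⊗ B` is injective because `Q` is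
projective. -/
lemma IsFlat.torOneZero [Small.{v} R] (hC : IsFlat C) (E : ModuleCat.{v} Rᵐᵒᵖ) :
    TorOneZero E C := by
  intro A B f g h
  obtain ⟨Q, hQ, q, hq⟩ := exists_projective_surjective E
  have hL := SES.ker_subtype hq
  have hid : Function.Surjective (LinearMap.id (R := R) (M := A)) := Function.surjective_id
  refine (injective_iff_map_eq_zero _).2 fun x hx => ?_
  obtain ⟨y, rfl⟩ := tensMap_surjective hq hid x
  rw [← tensMap_comm] at hx
  obtain ⟨z, hz⟩ := (tensMap_exact_left (F := B) hL.exact hq _).1 hx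
  have hgz : tensMap LinearMap.id g z = 0 := by
    apply (isFlat_iff C).1 hC _ hL.inj
    rw [map_zero, tensMap_comm, hz, tensMap_id_comp, h.exact.linearMap_comp_eq_zero,
      tensMap_zero_right]
  obtain ⟨w, rfl⟩ := (tensMap_exact_right h.exact h.surj z).1 hgz
  rw [tensMap_comm] at hz
  rw [← tensMap_injective_of_projective_left h.inj hz]
  exact (tensMap_exact_left (F := A) hL.exact hq).apply_apply_eq_zero w

/-- A short exact sequence with flat middle term detects the vanishing of `Tor_1`. -/
lemma TorOneZero.of_flat [Small.{v} R] {f : A →ₗ[R] B} {g : B →ₗ[R] C} (h : SES f g)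
    (hB : IsFlat B) (hf : TensorInjective E f) : TorOneZero E C := by
  intro A' B' f' g' h'
  obtain ⟨X, i, p, i', p', hi, hi', hpi, hpi', -⟩ := h.pullback h'
  refine (injective_iff_map_eq_zero _).2 fun x hx => ?_
  have hcomp : p ∘ₗ i' = f' := LinearMap.ext hpi'
  have hcomp' : p' ∘ₗ i = f := LinearMap.ext hpi
  rw [← hcomp, ← tensMap_id_comp] at hx
  obtain ⟨a, ha⟩ := (tensMap_exact_right hi.exact hi.surj _).1 hx
  -- In the pullback `X`, the image of `x` comes from some `a` in `E ⊗ A`; mapping on to `E ⊗ B`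
  -- kills it, while `f` is injective after tensoring.
  have ha0 : a = 0 := by
    apply hf
    rw [← hcomp', ← tensMap_id_comp, ha, map_zero, tensMap_id_comp,
      hi'.exact.linearMap_comp_eq_zero, tensMap_zero_right]
  apply hB.torOneZero E i' p' hi'
  rw [← ha, ha0, map_zero, map_zero]

/-- Since Tor with `C` vanishes, `G ⊗ A` embeds in `G ⊗ B`, which in turn embeds in `G' ⊗ B` for
every injection `G → G'`. -/
lemma IsFlat.ker [Small.{v} R] {f : A →ₗ[R] B} {g : B →ₗ[R] C} (h : SES f g)
    (hB : IsFlat B) (hC : IsFlat C) : IsFlat A := by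
  rw [isFlat_iff] at hB ⊢
  intro G G' _ _ _ _ e he x y hxy
  apply hC.torOneZero (ModuleCat.of Rᵐᵒᵖ G) f g h
  apply hB e he
  rw [tensMap_comm, hxy, tensMap_comm]

/-- `Tor_{n+1}(I, N) = 0` for all injective right modules `I`, expressed by dimension shifting. -/
def TorVanish : ℕ → ModuleCat.{v} R → Prop
  | 0, N => ∀ I : ModuleCat.{v} Rᵐᵒᵖ, Injective I → TorOneZero I N
  | n + 1, N => ∀ ⦃A B : ModuleCat.{v} R⦄ (f : A →ₗ[R] B) (g : B →ₗ[R] N),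
      SES f g → IsFlat B → TorVanish n A

/-- `TorVanish` quantifies over all flat presentations; the second part says that one is enough.
Comparing two presentations through their pullback, as in Schanuel's lemma, reduces it to the first
part at the same `n`: a flat quotient does not affect Tor vanishing. The first part at `n + 1`
follows from the second part at `n`, so the two are proved in one induction. -/
lemma torVanish_iff_and_succ [Small.{v} R] (n : ℕ) :
    (∀ ⦃A X B : ModuleCat.{v} R⦄ (f : A →ₗ[R] X) (g : X →ₗ[R] B), SES f g → IsFlat B →
      (TorVanish n A ↔ TorVanish n X)) ∧
    (∀ ⦃A B N : ModuleCat.{v} R⦄ (f : A →ₗ[R] B) (g : B →ₗ[R] N), SES f g → IsFlat B →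
      TorVanish n A → TorVanish (n + 1) N) := by
  have step : ∀ n, (∀ ⦃A X B : ModuleCat.{v} R⦄ (f : A →ₗ[R] X) (g : X →ₗ[R] B), SES f g →
      IsFlat B → (TorVanish n A ↔ TorVanish n X)) →
      (∀ ⦃A B N : ModuleCat.{v} R⦄ (f : A →ₗ[R] B) (g : B →ₗ[R] N), SES f g → IsFlat B →
        TorVanish n A → TorVanish (n + 1) N) := by
    intro n hS A B N f g h hB hA A' B' f' g' h' hB'
    obtain ⟨X, i, p, i', p', hi, hi', -⟩ := h.pullback h'
    exact (hS i' p' hi' hB).2 ((hS i p hi hB').1 hA)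
  -- Take a projective `P` onto `X` and let `P'` be the preimage of `A`. It is flat, being the
  -- kernel of `P → B`, so `A` and `X` get flat presentations with the same kernel `K`.
  have cover : ∀ ⦃A X B : ModuleCat.{v} R⦄ (f : A →ₗ[R] X) (g : X →ₗ[R] B), SES f g →
      IsFlat B → ∃ (K P' P : ModuleCat.{v} R) (k : K →ₗ[R] P) (b : P →ₗ[R] X) (j : K →ₗ[R] P')
        (q : P' →ₗ[R] A) (i : P' →ₗ[R] P), SES k b ∧ SES j q ∧ IsFlat P ∧ IsFlat P' ∧
        i ∘ₗ j = k ∧ ∀ E : ModuleCat.{v} Rᵐᵒᵖ, TensorInjective E i := by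
    intro A X B f g h hB
    obtain ⟨P, hP, b, hb⟩ := exists_projective_surjective X
    have hk := SES.ker_subtype hb
    have hi := SES.ker_subtype (g := g ∘ₗ b) (h.surj.comp hb)
    have hPf := isFlat_of_projective P
    obtain ⟨j, q, hjq, hij, -⟩ := h.comp_ker hk hi
    exact ⟨_, _, P, _, b, j, q, _, hk, hjq, hPf, hPf.ker hi hB, LinearMap.ext hij,
      fun E => hB.torOneZero E _ _ hi⟩
  induction n with
  | zero =>
    refine ⟨?_, step 0 ?_⟩ <;>
    · intro A X B f g h hB
      obtain ⟨K, P', P, k, b, j, q, i, hk, hjq, hP, hP', rfl, hi⟩ := cover f g h hB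
      exact ⟨fun hA I hI => .of_flat hk hP ((hi I).comp (hA I hI _ _ hjq)),
        fun hX I hI => .of_flat hjq hP' (hX I hI _ _ hk).of_comp⟩
  | succ n ih =>
    refine ⟨?_, step (n + 1) ?_⟩ <;>
    · intro A X B f g h hB
      obtain ⟨K, P', P, k, b, j, q, i, hk, hjq, hP, hP', rfl, hi⟩ := cover f g h hB
      exact ⟨fun hA => ih.2 _ _ hk hP (hA _ _ hjq hP'), fun hX => ih.2 _ _ hjq hP' (hX _ _ hk hP)⟩

lemma TorVanish.succ [Small.{v} R] {n : ℕ} {f : A →ₗ[R] B} {g : B →ₗ[R] C} (hA : TorVanish n A)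
    (h : SES f g) (hB : IsFlat B) : TorVanish (n + 1) C :=
  (torVanish_iff_and_succ n).2 f g h hB hA

end Tor

/-! ### Gorenstein flat modules as splices of short exact sequences. -/

section Splice

lemma exactAt_iff_function_exact {S : Type u} [Ring S] (K : ChainComplex (ModuleCat.{v} S) ℤ)
    {i j k : ℤ} (hi : j + 1 = i) (hk : k + 1 = j) :
    K.ExactAt j ↔ Function.Exact (K.d i j).hom (K.d j k).hom := by
  rw [K.exactAt_iff' i j k ((ComplexShape.down ℤ).prev_eq' hi)
    ((ComplexShape.down ℤ).next_eq' hk)]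
  exact ShortComplex.ShortExact.moduleCat_exact_iff_function_exact _

section

variable {S : Type u} [Ring S] {Z X : ℤ → ModuleCat.{v} S} {ι : ∀ n, Z n →ₗ[S] X n}
  {π : ∀ n, X (n + 1) →ₗ[S] Z n} (hses : ∀ n, SES (ι (n + 1)) (π n))

/-- The complex obtained by splicing short exact sequences `0 → Z (n + 1) → X (n + 1) → Z n → 0`. -/
def splice : ChainComplex (ModuleCat.{v} S) ℤ :=
  ChainComplex.of X (fun n => ModuleCat.ofHom (ι n ∘ₗ π n)) (fun n => by
    ext x
    simp [(hses n).exact.apply_apply_eq_zero])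

lemma splice_d (n : ℤ) : (splice hses).d (n + 1) n = ModuleCat.ofHom (ι n ∘ₗ π n) :=
  ChainComplex.of_d X (fun n => ModuleCat.ofHom (ι n ∘ₗ π n)) n

lemma splice_injective {S : Type u} [Ring S] {Z X : ℤ → ModuleCat.{v} S} {ι : ∀ n, Z n →ₗ[S] X n}
    {π : ∀ n, X (n + 1) →ₗ[S] Z n} (hses : ∀ n, SES (ι (n + 1)) (π n)) (n : ℤ) :
    Function.Injective (ι n) := by
  obtain ⟨n, rfl⟩ : ∃ m, n = m + 1 := ⟨n - 1, by omega⟩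
  exact (hses n).inj

lemma splice_ker {n i : ℤ} (hi : n + 1 = i) :
    Nonempty (Z i ≃ₗ[S] LinearMap.ker ((splice hses).d i n).hom) := by
  subst hi
  obtain ⟨e, -⟩ := (hses n).exists_equiv_ker
  have hk : LinearMap.ker ((splice hses).d (n + 1) n).hom = LinearMap.ker (π n) := by
    rw [splice_d]
    ext x
    exact map_eq_zero_iff _ (splice_injective hses n)
  exact ⟨e.trans (LinearEquiv.ofEq _ _ hk.symm)⟩

lemma splice_acyclic : (splice hses).Acyclic := by
  intro n
  obtain ⟨n, rfl⟩ : ∃ m, n = m + 1 := ⟨n - 1, by omega⟩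
  rw [exactAt_iff_function_exact _ rfl rfl, splice_d, splice_d]
  intro x
  change ι n (π n x) = 0 ↔ x ∈ Set.range (fun y => ι (n + 1) (π (n + 1) y))
  rw [map_eq_zero_iff _ (splice_injective hses n), (hses n).exact x]
  constructor
  · rintro ⟨z, rfl⟩
    obtain ⟨y, rfl⟩ := (hses (n + 1)).surj z
    exact ⟨y, rfl⟩
  · rintro ⟨y, rfl⟩
    exact ⟨_, rfl⟩

end

variable {R : Type u} [Ring R]

lemma tensMap_id_surjective {E : ModuleCat.{v} Rᵐᵒᵖ} {A B : ModuleCat.{v} R} {g : A →ₗ[R] B}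
    (hg : Function.Surjective g) :
    Function.Surjective (tensMap (LinearMap.id (R := Rᵐᵒᵖ) (M := E)) g) :=
  tensMap_surjective (show Function.Surjective (LinearMap.id (R := Rᵐᵒᵖ) (M := E)) from
    Function.surjective_id) hg

/-- `N` is Gorenstein flat if and only if it is the zeroth term of a doubly infinite family of
modules `Z n` with short exact sequences `0 → Z (n + 1) → X (n + 1) → Z n → 0`, where the `X n`
are flat, that stay exact under `I ⊗_R -` for every injective right module `I`. -/
lemma isGorensteinFlat_iff (N : ModuleCat.{v} R) : IsGorensteinFlat N ↔
    ∃ (Z X : ℤ → ModuleCat.{v} R) (ι : ∀ n, Z n →ₗ[R] X n) (π : ∀ n, X (n + 1) →ₗ[R] Z n),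
      (∀ n, SES (ι (n + 1)) (π n)) ∧ (∀ n, IsFlat (X n)) ∧
      (∀ I : ModuleCat.{v} Rᵐᵒᵖ, Injective I → ∀ n, TensorInjective I (ι n)) ∧
      Nonempty (N ≃ₗ[R] Z 0) := by
  constructor
  · rintro ⟨T, hflat, hT, hI, ⟨e⟩⟩
    have hex : ∀ n, Function.Exact (T.d (n + 1) n).hom (T.d n (n - 1)).hom := fun n =>
      (exactAt_iff_function_exact T rfl (by omega)).1 (hT n)
    let Z : ℤ → ModuleCat.{v} R := fun n => ModuleCat.of R (LinearMap.ker (T.d n (n - 1)).hom)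
    let ι : ∀ n, Z n →ₗ[R] T.X n := fun n => (LinearMap.ker (T.d n (n - 1)).hom).subtype
    let π : ∀ n, T.X (n + 1) →ₗ[R] Z n := fun n =>
      LinearMap.codRestrict _ (T.d (n + 1) n).hom (fun x => (hex n).apply_apply_eq_zero x)
    have hker : ∀ n x, (T.d (n + 1) (n + 1 - 1)).hom x = 0 ↔ (T.d (n + 1) n).hom x = 0 := by
      intro n x
      rw [show n + 1 - 1 = n by omega]
    have hses : ∀ n, SES (ι (n + 1)) (π n) := by
      refine fun n => ⟨Submodule.injective_subtype _, fun x => ?_, ?_⟩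
      · rw [show π n x = 0 ↔ (T.d (n + 1) n).hom x = 0 from Subtype.ext_iff, ← hker]
        exact ⟨fun h => ⟨⟨x, h⟩, rfl⟩, by rintro ⟨y, rfl⟩; exact y.2⟩
      · rintro ⟨z, hz⟩
        obtain ⟨x, hx⟩ := (hex n z).1 hz
        exact ⟨x, Subtype.ext hx⟩
    refine ⟨Z, T.X, ι, π, hses, hflat, ?_, ⟨e.toLinearEquiv⟩⟩
    -- As `I ⊗ -` is right exact, `I ⊗ ι n` is injective exactly when the kernel of `I ⊗ d` is no
    -- larger than that of `I ⊗ π n`; exactness of `I ⊗ T` provides this.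
    intro I hI' n
    refine (injective_iff_map_eq_zero _).2 fun x hx => ?_
    obtain ⟨y, rfl⟩ := tensMap_id_surjective (E := I) (hses n).surj x
    have hexI := (exactAt_iff_function_exact (tensorModuleComplex I T)
      (i := n + 1 + 1) (j := n + 1) (k := n) rfl rfl).1 (hI I hI' (n + 1))
    have hcomp : ∀ n, ι n ∘ₗ π n = (T.d (n + 1) n).hom := fun n => rfl
    rw [tensMap_id_comp, hcomp] at hx
    obtain ⟨z, hz⟩ : ∃ z : Tens R I (T.X (n + 1 + 1)),
      tensMap LinearMap.id (T.d (n + 1 + 1) (n + 1)).hom z = y := (hexI y).1 hx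
    rw [← hcomp, ← tensMap_id_comp] at hz
    rw [← hz, tensMap_id_comp, (hses n).exact.linearMap_comp_eq_zero, tensMap_zero_right]
  · rintro ⟨Z, X, ι, π, hses, hflat, hI, ⟨e⟩⟩
    have hTd := splice_d hses
    refine ⟨splice hses, hflat, splice_acyclic hses, ?_, ?_⟩
    · intro I hI' n
      obtain ⟨n, rfl⟩ : ∃ m, n = m + 1 := ⟨n - 1, by omega⟩
      rw [exactAt_iff_function_exact _ rfl rfl]
      change Function.Exact (tensMap (LinearMap.id (R := Rᵐᵒᵖ) (M := I))
          ((splice hses).d (n + 1 + 1) (n + 1)).hom)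
        (tensMap (LinearMap.id (R := Rᵐᵒᵖ) (M := I)) ((splice hses).d (n + 1) n).hom)
      rw [hTd, hTd]
      intro (x : Tens R I (X (n + 1)))
      change tensMap LinearMap.id (ι n ∘ₗ π n) x = 0 ↔
        ∃ y : Tens R I (X (n + 1 + 1)), tensMap LinearMap.id (ι (n + 1) ∘ₗ π (n + 1)) y = x
      simp only [← tensMap_id_comp]
      rw [map_eq_zero_iff _ (hI I hI' n), tensMap_exact_right (hses n).exact (hses n).surj x]
      constructor
      · rintro ⟨z, rfl⟩
        obtain ⟨y, rfl⟩ := tensMap_id_surjective (E := I) (hses (n + 1)).surj z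
        exact ⟨y, rfl⟩
      · rintro ⟨y, rfl⟩
        exact ⟨_, rfl⟩
    · obtain ⟨e'⟩ := splice_ker hses (show (-1 : ℤ) + 1 = 0 by rfl)
      exact ⟨(e.trans e').toModuleIso⟩

/-- A class of modules is contained in the class of Gorenstein flat modules if each of its members
`N` has vanishing `Tor_1(I, N)` for injective `I`, is a submodule of a flat module with quotient in
the class, and is a quotient of a flat module with kernel in the class. -/
lemma isGorensteinFlat_of_class (𝒢 : ModuleCat.{v} R → Prop)
    (hTor : ∀ N, 𝒢 N → ∀ I : ModuleCat.{v} Rᵐᵒᵖ, Injective I → TorOneZero I N)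
    (hright : ∀ N, 𝒢 N → ∃ (T N' : ModuleCat.{v} R) (f : N →ₗ[R] T) (g : T →ₗ[R] N'),
      SES f g ∧ IsFlat T ∧ 𝒢 N')
    (hleft : ∀ N, 𝒢 N → ∃ (N' T : ModuleCat.{v} R) (f : N' →ₗ[R] T) (g : T →ₗ[R] N),
      SES f g ∧ IsFlat T ∧ 𝒢 N')
    {N : ModuleCat.{v} R} (hN : 𝒢 N) : IsGorensteinFlat N := by
  choose Tr Nr fr gr hr hTr hNr using hright
  choose Nl Tl fl gl hl hTl hNl using hleft
  -- Iterated cosyzygies `r` fill the negative degrees and iterated syzygies `l` the nonnegative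
  -- ones; both start at `N`, and only `l 0` is used as `Z 0`.
  let r : ℕ → {N // 𝒢 N} := Nat.rec ⟨N, hN⟩ (fun _ N => ⟨Nr N.1 N.2, hNr N.1 N.2⟩)
  let l : ℕ → {N // 𝒢 N} := Nat.rec ⟨N, hN⟩ (fun _ N => ⟨Nl N.1 N.2, hNl N.1 N.2⟩)
  let Z : ℤ → ModuleCat.{v} R := fun
    | Int.ofNat n => (l n).1
    | Int.negSucc n => (r (n + 1)).1
  let X : ℤ → ModuleCat.{v} R := fun
    | Int.ofNat 0 => Tr _ (r 0).2
    | Int.ofNat (n + 1) => Tl _ (l n).2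
    | Int.negSucc n => Tr _ (r (n + 1)).2
  let ι : ∀ n, Z n →ₗ[R] X n := fun
    | Int.ofNat 0 => fr _ (r 0).2
    | Int.ofNat (n + 1) => fl _ (l n).2
    | Int.negSucc n => fr _ (r (n + 1)).2
  let π : ∀ n, X (n + 1) →ₗ[R] Z n := fun
    | Int.ofNat n => gl _ (l n).2
    | Int.negSucc 0 => gr _ (r 0).2
    | Int.negSucc (n + 1) => gr _ (r (n + 1)).2
  have hZ : ∀ n, 𝒢 (Z n) := fun
    | Int.ofNat n => (l n).2
    | Int.negSucc n => (r (n + 1)).2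
  have hses : ∀ n, SES (ι (n + 1)) (π n) := fun
    | Int.ofNat n => hl _ (l n).2
    | Int.negSucc 0 => hr _ (r 0).2
    | Int.negSucc (n + 1) => hr _ (r (n + 1)).2
  refine (isGorensteinFlat_iff N).2 ⟨Z, X, ι, π, hses, ?_, ?_, ⟨LinearEquiv.refl R N⟩⟩
  · rintro ((_ | n) | n)
    · exact hTr _ (r 0).2
    · exact hTl _ (l n).2
    · exact hTr _ (r (n + 1)).2
  · intro I hI n
    obtain ⟨n, rfl⟩ : ∃ m, n = m + 1 := ⟨n - 1, by omega⟩
    -- The inclusion in degree `n + 1` has cokernel `Z n`, so vanishing of Tor for `Z n` keeps it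
    -- injective.
    exact hTor _ (hZ n) I hI _ _ (hses n)

end Splice

/-! ### Closure properties of Gorenstein flat modules. -/

section GorensteinFlatModules

variable {R : Type u} [Ring R] {A B C K T G : ModuleCat.{v} R}

lemma IsGorensteinFlat.of_equiv (hA : IsGorensteinFlat A) (e : A ≃ₗ[R] B) :
    IsGorensteinFlat B := by
  obtain ⟨T, h1, h2, h3, ⟨e'⟩⟩ := hA
  exact ⟨T, h1, h2, h3, ⟨e.symm.toModuleIso ≪≫ e'⟩⟩

/-- The defining complex also serves the cosyzygy `Z (-1)`. Instead of shifting it, the class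
criterion is applied to all modules isomorphic to some `Z n`. -/
lemma IsGorensteinFlat.exists_right [Small.{v} R] (hG : IsGorensteinFlat G) :
    ∃ (T N : ModuleCat.{v} R) (f : G →ₗ[R] T) (g : T →ₗ[R] N),
      SES f g ∧ IsFlat T ∧ IsGorensteinFlat N := by
  obtain ⟨Z, X, ι, π, hses, hflat, hI, ⟨e⟩⟩ := (isGorensteinFlat_iff G).1 hG
  refine ⟨X (-1 + 1), Z (-1), ι (-1 + 1) ∘ₗ e.toLinearMap, π (-1), (hses (-1)).equiv_left e,
    hflat _, ?_⟩
  refine isGorensteinFlat_of_class (fun N => ∃ n, Nonempty (N ≃ₗ[R] Z n)) ?_ ?_ ?_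
    ⟨-1, ⟨LinearEquiv.refl R _⟩⟩
  · rintro N ⟨n, ⟨e⟩⟩ I hI'
    exact .of_flat ((hses n).equiv_right e.symm) (hflat _) (hI I hI' _)
  · rintro N ⟨n, ⟨e⟩⟩
    obtain ⟨n, rfl⟩ : ∃ m, n = m + 1 := ⟨n - 1, by omega⟩
    exact ⟨_, _, _, _, (hses n).equiv_left e, hflat _, n, ⟨LinearEquiv.refl R _⟩⟩
  · rintro N ⟨n, ⟨e⟩⟩
    exact ⟨_, _, _, _, (hses n).equiv_right e.symm, hflat _, n + 1, ⟨LinearEquiv.refl R _⟩⟩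

/-- Each `Z m` is a flat module modulo `Z (m + 1)`, so vanishing in degree one for all `m`
propagates to every degree by dimension shifting. -/
lemma IsGorensteinFlat.torVanish [Small.{v} R] (hG : IsGorensteinFlat G) (n : ℕ) :
    TorVanish n G := by
  obtain ⟨Z, X, ι, π, hses, hflat, hI, ⟨e⟩⟩ := (isGorensteinFlat_iff G).1 hG
  have hZ : ∀ n m, TorVanish n (Z m) := by
    intro n
    induction n with
    | zero => exact fun m I hI' => .of_flat (hses m) (hflat _) (hI I hI' _)
    | succ n ih => exact fun m => (ih (m + 1)).succ (hses m) (hflat _)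
  have hses' := (hses 0).equiv_right e.symm
  cases n with
  | zero => exact fun I hI' => .of_flat hses' (hflat _) (hI I hI' _)
  | succ n => exact (hZ n (0 + 1)).succ hses' (hflat _)

/-- The modules with vanishing `Tor_i(I, -)`, for `I` injective and `i > 0`, that have a finite
coresolution by such modules with flat terms ending in a Gorenstein flat module. -/
inductive FlatCoresolved : ModuleCat.{v} R → Prop
  | base {N : ModuleCat.{v} R} : IsGorensteinFlat N → FlatCoresolved N
  | step {N T N' : ModuleCat.{v} R} (f : N →ₗ[R] T) (g : T →ₗ[R] N') :
      (∀ n, TorVanish n N) → SES f g → IsFlat T → FlatCoresolved N' → FlatCoresolved N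

/-- The kernel of a surjection from a flat module to a Gorenstein flat module is
Gorenstein flat. -/
lemma IsGorensteinFlat.ker_of_flat [Small.{v} R] {f : K →ₗ[R] T} {g : T →ₗ[R] G} (h : SES f g)
    (hT : IsFlat T) (hG : IsGorensteinFlat G) : IsGorensteinFlat K := by
  have tor : ∀ {N : ModuleCat.{v} R}, FlatCoresolved N → ∀ n, TorVanish n N := by
    rintro N (hN | ⟨_, _, hN, -⟩)
    · exact hN.torVanish
    · exact hN
  refine isGorensteinFlat_of_class FlatCoresolved (fun N hN => tor hN 0) ?_ ?_
    -- `TorVanish (n + 1) G` unfolds to `TorVanish n` of the kernel in any flat presentation of `G`,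
    -- here of `K`.
    (.step f g (fun n => hG.torVanish (n + 1) f g h hT) h hT (.base hG))
  · rintro N (hN | ⟨f, g, -, h, hT, hN⟩)
    · obtain ⟨T, N', f, g, h, hT, hN'⟩ := hN.exists_right
      exact ⟨T, N', f, g, h, hT, .base hN'⟩
    · exact ⟨_, _, f, g, h, hT, hN⟩
  · intro N hN
    obtain ⟨P, hP, p, hp⟩ := exists_projective_surjective N
    have hk := SES.ker_subtype hp
    have hPf := isFlat_of_projective P
    exact ⟨_, P, _, p, hk, hPf, .step _ p (fun n => tor hN (n + 1) _ _ hk hPf) hk hPf hN⟩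

lemma IsFlat.isGorensteinFlat [Small.{v} R] (hA : IsFlat A) : IsGorensteinFlat A := by
  refine isGorensteinFlat_of_class IsFlat (fun N hN I _ => hN.torOneZero I) ?_ ?_ hA
  · intro N hN
    exact ⟨N, ModuleCat.of R PUnit, LinearMap.id, 0,
      ⟨Function.injective_id, fun x => by simp, fun _ => ⟨0, rfl⟩⟩, hN,
      isFlat_of_subsingleton _⟩
  · intro N hN
    exact ⟨ModuleCat.of R PUnit, N, 0, LinearMap.id,
      ⟨fun _ _ _ => rfl, fun x => by simp [eq_comm], Function.surjective_id⟩, hN,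
      isFlat_of_subsingleton _⟩

lemma IsLeftGFClosed.extension (hR : IsLeftGFClosed.{u, v} R) {f : A →ₗ[R] B} {g : B →ₗ[R] C}
    (h : SES f g) (hA : IsGorensteinFlat A) (hC : IsGorensteinFlat C) : IsGorensteinFlat B := by
  let S : ShortComplex (ModuleCat.{v} R) := ShortComplex.mk (ModuleCat.ofHom f) (ModuleCat.ofHom g)
    (by ext x; exact h.exact.apply_apply_eq_zero x)
  have hS : S.ShortExact :=
    { exact := (ShortComplex.ShortExact.moduleCat_exact_iff_function_exact S).2 h.exact
      mono_f := (ModuleCat.mono_iff_injective _).2 h.inj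
      epi_g := (ModuleCat.epi_iff_surjective _).2 h.surj }
  exact hR S hS hA hC

/-- Over a left GF-closed ring, the kernel of a surjection of Gorenstein flat modules is
Gorenstein flat. -/
lemma IsLeftGFClosed.ker [Small.{v} R] (hR : IsLeftGFClosed.{u, v} R) {f : K →ₗ[R] B}
    {g : B →ₗ[R] C} (h : SES f g) (hB : IsGorensteinFlat B) (hC : IsGorensteinFlat C) :
    IsGorensteinFlat K := by
  obtain ⟨T, N, i, p, hi, hT, hN⟩ := hB.exists_right
  -- `L` is the copy of `K` inside the flat module `T`.
  let L : Submodule R T := LinearMap.range (i ∘ₗ f)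
  have hL := SES.mkQ (B := T) L
  obtain ⟨e⟩ : Nonempty (K ≃ₗ[R] L) := ⟨LinearEquiv.ofInjective _ (hi.inj.comp h.inj)⟩
  have hpL : L ≤ LinearMap.ker p := by
    rintro _ ⟨x, rfl⟩
    exact hi.exact.apply_apply_eq_zero _
  let c : B →ₗ[R] (T ⧸ L) := L.mkQ ∘ₗ i
  have hc : LinearMap.ker g = LinearMap.ker c := by
    ext x
    rw [LinearMap.mem_ker, LinearMap.mem_ker, h.exact x]
    change _ ↔ L.mkQ (i x) = 0
    rw [Submodule.mkQ_apply, Submodule.Quotient.mk_eq_zero]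
    constructor
    · rintro ⟨y, rfl⟩
      exact ⟨y, rfl⟩
    · rintro ⟨y, hy⟩
      exact ⟨y, hi.inj hy⟩
  let j : C →ₗ[R] ModuleCat.of R (T ⧸ L) :=
    (LinearMap.ker g).liftQ c hc.le ∘ₗ (g.quotKerEquivOfSurjective h.surj).symm.toLinearMap
  have hj : ∀ x, j (g x) = c x := by
    intro x
    have : (g.quotKerEquivOfSurjective h.surj).symm (g x) = (LinearMap.ker g).mkQ x := by
      rw [LinearEquiv.symm_apply_eq]; rfl
    simp [j, this]
  -- The sequence is `0 → C → T/L → N → 0`, with `C ≅ B/K`. This is where closure under extensions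
  -- enters.
  have hTL : IsGorensteinFlat (ModuleCat.of R (T ⧸ L)) := by
    refine hR.extension (f := j) (g := L.liftQ p hpL) ⟨?_, ?_, ?_⟩ hC hN
    · refine (injective_iff_map_eq_zero _).2 fun y hy => ?_
      obtain ⟨x, rfl⟩ := h.surj y
      rw [hj] at hy
      exact hc.ge hy
    · intro y
      obtain ⟨t, rfl⟩ := Submodule.mkQ_surjective _ y
      rw [Submodule.mkQ_apply, Submodule.liftQ_apply, hi.exact t]
      constructor
      · rintro ⟨x, rfl⟩
        exact ⟨g x, hj x⟩
      · rintro ⟨y, hy⟩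
        obtain ⟨x, rfl⟩ := h.surj y
        rw [hj] at hy
        obtain ⟨z, hz⟩ := (Submodule.Quotient.eq L).1 hy
        exact ⟨x - f z, by rw [map_sub]; erw [hz]; abel⟩
    · intro n
      obtain ⟨t, rfl⟩ := hi.surj n
      exact ⟨L.mkQ t, rfl⟩
  exact (IsGorensteinFlat.ker_of_flat hL hT hTL).of_equiv e.symm

end GorensteinFlatModules

/-! ### Gorenstein flat dimension by recursion on syzygies. -/

section Dimension

variable {R : Type u} [Ring R]

/-- `M` has a Gorenstein flat resolution of length `n`, by recursion on `n`. -/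
def GFDimLE : ℕ → ModuleCat.{v} R → Prop
  | 0, M => IsGorensteinFlat M
  | n + 1, M => ∃ (N G : ModuleCat.{v} R) (f : N →ₗ[R] G) (g : G →ₗ[R] M),
      SES f g ∧ IsGorensteinFlat G ∧ GFDimLE n N

variable {A B C K M N P G : ModuleCat.{v} R}

lemma GFDimLE.of_equiv {n : ℕ} (hA : GFDimLE n A) (e : A ≃ₗ[R] B) : GFDimLE n B := by
  cases n with
  | zero => exact IsGorensteinFlat.of_equiv hA e
  | succ n =>
    obtain ⟨N, G, f, g, h, hG, hN⟩ := hA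
    exact ⟨N, G, f, _, h.equiv_right e, hG, hN⟩

/-- If `H → A` starts a resolution, the preimage of `K` in `H` is the kernel of `H → G`, hence
Gorenstein flat, and it covers `K` with the same first syzygy. -/
lemma GFDimLE.ker [Small.{v} R] (hR : IsLeftGFClosed.{u, v} R) {n : ℕ} {f : K →ₗ[R] A}
    {g : A →ₗ[R] G} (h : SES f g) (hA : GFDimLE n A) (hG : IsGorensteinFlat G) :
    GFDimLE n K := by
  cases n with
  | zero => exact hR.ker h hA hG
  | succ n =>
    obtain ⟨N, H, f', g', h', hH, hN⟩ := hA
    have hi := SES.ker_subtype (g := g ∘ₗ g') (h.surj.comp h'.surj)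
    obtain ⟨j, q, hjq, -⟩ := h.comp_ker h' hi
    exact ⟨N, _, j, q, hjq, hR.ker hi hH hG, hN⟩

/-- The extension splits, so a cover `H → N` extends to `H × P → A` without changing the kernel. -/
lemma GFDimLE.extension_projective [Small.{v} R] (hR : IsLeftGFClosed.{u, v} R) {n : ℕ}
    {f : N →ₗ[R] A} {g : A →ₗ[R] P} (h : SES f g) (hN : GFDimLE n N) [Module.Projective R P] :
    GFDimLE n A := by
  have hP : IsGorensteinFlat P := (isFlat_of_projective P).isGorensteinFlat
  cases n with
  | zero => exact hR.extension h hN hP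
  | succ n =>
    obtain ⟨N', H, f', g', h', hH, hN'⟩ := hN
    obtain ⟨s, hs⟩ := Module.projective_lifting_property g LinearMap.id h.surj
    have hs' : ∀ x, g (s x) = x := fun x => LinearMap.congr_fun hs x
    let p : H × P →ₗ[R] A := (f ∘ₗ g').coprod s
    have hp : ∀ x y, p (x, y) = f (g' x) + s y := fun x y => rfl
    refine ⟨N', ModuleCat.of R (H × P), LinearMap.inl R H P ∘ₗ f', p, ⟨?_, ?_, ?_⟩, ?_, hN'⟩
    · exact LinearMap.inl_injective.comp h'.inj
    · rintro ⟨x, y⟩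
      constructor
      · intro hxy
        rw [hp] at hxy
        have hy : y = 0 := by
          have := congrArg g hxy
          simpa [h.exact.apply_apply_eq_zero, hs'] using this
        subst hy
        rw [map_zero, add_zero, map_eq_zero_iff _ h.inj] at hxy
        obtain ⟨z, rfl⟩ := (h'.exact x).1 hxy
        exact ⟨z, rfl⟩
      · rintro ⟨z, hz⟩
        rw [← hz]
        change p (f' z, 0) = 0
        rw [hp, h'.exact.apply_apply_eq_zero, map_zero, map_zero, add_zero]
    · intro a
      obtain ⟨y, hy⟩ := (h.exact (a - s (g a))).1 (by rw [map_sub, hs', sub_self])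
      obtain ⟨x, rfl⟩ := h'.surj y
      exact ⟨(x, g a), by rw [hp, hy]; abel⟩
    · exact hR.extension (f := LinearMap.inl R H P) (g := LinearMap.snd R H P)
        ⟨LinearMap.inl_injective, Function.Exact.inl_snd, LinearMap.snd_surjective⟩ hH hP

/-- The subtraction is truncated: a syzygy of a Gorenstein flat module is again Gorenstein flat.
Otherwise the pullback `X` of `P` and `G` over `M` is an extension of `P` by `N`, and `K` is the
kernel of `X → G`. -/
lemma GFDimLE.syzygy [Small.{v} R] (hR : IsLeftGFClosed.{u, v} R) {n : ℕ} {f : K →ₗ[R] P}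
    {g : P →ₗ[R] M} (h : SES f g) [Module.Projective R P] (hM : GFDimLE n M) :
    GFDimLE (n - 1) K := by
  cases n with
  | zero => exact IsGorensteinFlat.ker_of_flat h (isFlat_of_projective P) hM
  | succ n =>
    obtain ⟨N, G, f', g', h', hG, hN⟩ := hM
    obtain ⟨X, i, p, i', p', hi, hi', -⟩ := h.pullback h'
    exact GFDimLE.ker hR hi (hN.extension_projective hR hi') hG

lemma GFDimLE.hasGFResolution [Small.{v} R] {n : ℕ} (hM : GFDimLE n M) : HasGFResolution M n := by
  induction n generalizing M with
  | zero =>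
    have hsub : ∀ i > 0, Subsingleton (((ChainComplex.single₀ _).obj M).X i) := fun i hi =>
      ModuleCat.subsingleton_of_isZero
        (HomologicalComplex.isZero_single_obj_X (ComplexShape.down ℕ) 0 M i (by omega))
    refine ⟨(ChainComplex.single₀ _).obj M, 𝟙 M, ?_, hsub, Function.surjective_id, ?_, ?_⟩
    · intro i hi
      obtain rfl : i = 0 := by omega
      exact hM
    · intro x
      constructor
      · intro hx
        exact ⟨0, by rw [map_zero]; exact hx.symm⟩
      · rintro ⟨y, rfl⟩
        have := hsub 1 one_pos
        rw [Subsingleton.elim y 0, map_zero, map_zero]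
    · intro i x
      have := hsub (i + 1) i.succ_pos
      rw [Subsingleton.elim x 0, map_zero]
      exact ⟨fun _ => ⟨0, map_zero _⟩, fun _ => rfl⟩
  | succ n ih =>
    obtain ⟨N, G, f, g, h, hG, hN⟩ := hM
    obtain ⟨P, π, h1, h2, h3, h4, h5⟩ := ih hN
    have hw : P.d 1 0 ≫ (π ≫ ModuleCat.ofHom f) = 0 := by
      ext x
      simp [h4.apply_apply_eq_zero x]
    refine ⟨P.augment (π ≫ ModuleCat.ofHom f) hw, ModuleCat.ofHom g, ?_, ?_, h.surj, ?_, ?_⟩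
    · rintro (_ | i) hi
      · exact hG
      · exact h1 i (by omega)
    · rintro (_ | i) hi
      · omega
      · exact h2 i (by omega)
    · intro x
      change g x = 0 ↔ ∃ y, f (π y) = x
      rw [h.exact x]
      constructor
      · rintro ⟨y, rfl⟩
        obtain ⟨z, rfl⟩ := h3 y
        exact ⟨z, rfl⟩
      · rintro ⟨y, rfl⟩
        exact ⟨_, rfl⟩
    · rintro (_ | i)
      · intro x
        change f (π x) = 0 ↔ _
        rw [map_eq_zero_iff _ h.inj]
        exact h4 x
      · exact h5 i

lemma HasGFResolution.gfDimLE {n : ℕ} (hM : HasGFResolution M n) : GFDimLE n M := by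
  induction n generalizing M with
  | zero =>
    obtain ⟨P, π, h1, h2, h3, h4, -⟩ := hM
    have := h2 1 (by omega)
    refine (h1 0 le_rfl).of_equiv (LinearEquiv.ofBijective π.hom ⟨?_, h3⟩)
    refine (injective_iff_map_eq_zero _).2 fun x hx => ?_
    obtain ⟨y, rfl⟩ := (h4 x).1 hx
    rw [Subsingleton.elim y 0, map_zero]
  | succ n ih =>
    obtain ⟨P, π, h1, h2, h3, h4, h5⟩ := hM
    refine ⟨ModuleCat.of R (LinearMap.ker π.hom), P.X 0, (LinearMap.ker π.hom).subtype, π.hom,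
      SES.ker_subtype h3, h1 0 (by omega), ih ?_⟩
    refine ⟨ChainComplex.truncate.obj P, ModuleCat.ofHom (LinearMap.codRestrict _ (P.d 1 0).hom
      fun x => h4.apply_apply_eq_zero x), fun i hi => h1 (i + 1) (by omega),
      fun i hi => h2 (i + 1) (by omega), ?_, ?_, fun i => h5 (i + 1)⟩
    · rintro ⟨x, hx⟩
      obtain ⟨y, hy⟩ := (h4 x).1 hx
      exact ⟨y, Subtype.ext hy⟩
    · intro x
      exact Subtype.ext_iff.trans (h5 0 x)

end Dimension

/-! ### Components of the tensor product of two complexes. -/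

section Total

variable {R : Type u} [Ring R] (E : ChainComplex (ModuleCat.{v} Rᵐᵒᵖ) ℤ)
  (F : ChainComplex (ModuleCat.{v} R) ℤ)

/-- The inclusion of `E_p ⊗_R F_q` into the tensor product of complexes. -/
def tensorι (p q n : ℤ) (h : p + q = n) :
    Tens R (E.X p) (F.X q) →ₗ[ℤ] (tensorComplex E F).X n :=
  (HomologicalComplex.ιMapBifunctor E F (tensor.{u, v} R) (ComplexShape.down ℤ) p q n h).hom

/-- The projection of the tensor product of complexes onto `E_p ⊗_R F_q`. -/
def tensorProj (p q n : ℤ) : (tensorComplex E F).X n →ₗ[ℤ] Tens R (E.X p) (F.X q) :=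
  (HomologicalComplex.mapBifunctorDesc (K₁ := E) (K₂ := F) (F := tensor.{u, v} R)
    (c := ComplexShape.down ℤ) (j := n) (A := ((tensor.{u, v} R).obj (E.X p)).obj (F.X q))
    (fun i j _ => if h : i = p ∧ j = q then eqToHom (by rw [h.1, h.2]) else 0)).hom

variable {E F}

lemma tensorProj_tensorι (p q n : ℤ) (h : p + q = n) (x : Tens R (E.X p) (F.X q)) :
    tensorProj E F p q n (tensorι E F p q n h x) = x := by
  have := HomologicalComplex.ι_mapBifunctorDesc (K₁ := E) (K₂ := F) (F := tensor.{u, v} R)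
    (c := ComplexShape.down ℤ) (j := n) (A := ((tensor.{u, v} R).obj (E.X p)).obj (F.X q))
    (fun i j _ => if h : i = p ∧ j = q then eqToHom (by rw [h.1, h.2]) else 0) p q h
  have h2 := ConcreteCategory.congr_hom this x
  rw [dif_pos ⟨rfl, rfl⟩] at h2
  exact h2

lemma tensorProj_tensorι_of_ne (p q p' q' n : ℤ) (h : p' + q' = n) (hne : ¬ (p' = p ∧ q' = q))
    (x : Tens R (E.X p') (F.X q')) :
    tensorProj E F p q n (tensorι E F p' q' n h x) = 0 := by
  have := HomologicalComplex.ι_mapBifunctorDesc (K₁ := E) (K₂ := F) (F := tensor.{u, v} R)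
    (c := ComplexShape.down ℤ) (j := n) (A := ((tensor.{u, v} R).obj (E.X p)).obj (F.X q))
    (fun i j _ => if h : i = p ∧ j = q then eqToHom (by rw [h.1, h.2]) else 0) p' q' h
  have h2 := ConcreteCategory.congr_hom this x
  rw [dif_neg hne] at h2
  exact h2

/-- The quotient map by `S` vanishes on every summand, so it is zero by the universal property. This
serves as the induction principle for elements of the tensor complex. -/
lemma mem_of_tensorι_mem {n : ℤ} (S : Submodule ℤ ((tensorComplex E F).X n))
    (h : ∀ p q h x, tensorι E F p q n h x ∈ S) (x : (tensorComplex E F).X n) : x ∈ S := by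
  let Q : ModuleCat.{v} ℤ :=
    @ModuleCat.of ℤ _ ((tensorComplex E F).X n ⧸ S) _ (Submodule.Quotient.module S)
  let f : (tensorComplex E F).X n ⟶ Q :=
    @ModuleCat.ofHom ℤ _ _ _ _ _ _ (Submodule.Quotient.module S) S.mkQ
  have h0 : f = 0 := by
    refine HomologicalComplex.mapBifunctor.hom_ext fun p q hpq => ?_
    refine ConcreteCategory.hom_ext _ _ fun y => ?_
    exact (Submodule.Quotient.mk_eq_zero S).2 (h p q hpq y)
  exact (Submodule.Quotient.mk_eq_zero S).1 (ConcreteCategory.congr_hom h0 x)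

/-- Allowing every larger index set `t` makes the property additive, since two elements can be
compared over the union of their supports. -/
lemma exists_finset_sum_tensorι {n : ℤ} (x : (tensorComplex E F).X n) :
    ∃ s : Finset ℤ, ∀ t, s ⊆ t →
      x = ∑ p ∈ t, tensorι E F p (n - p) n (by omega) (tensorProj E F p (n - p) n x) := by
  let S : Submodule ℤ ((tensorComplex E F).X n) :=
    { carrier := {x | ∃ s : Finset ℤ, ∀ t, s ⊆ t →
        x = ∑ p ∈ t, tensorι E F p (n - p) n (by omega) (tensorProj E F p (n - p) n x)}
      zero_mem' := ⟨∅, fun t _ => by simp⟩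
      add_mem' := by
        rintro x y ⟨s, hs⟩ ⟨s', hs'⟩
        refine ⟨s ∪ s', fun t ht => ?_⟩
        simp only [map_add, Finset.sum_add_distrib]
        rw [← hs t (Finset.union_subset_left ht), ← hs' t (Finset.union_subset_right ht)]
      smul_mem' := by
        rintro a x ⟨s, hs⟩
        refine ⟨s, fun t ht => ?_⟩
        conv_lhs => rw [hs t ht]
        rw [Finset.smul_sum]
        refine Finset.sum_congr rfl fun p _ => ?_
        simp only [map_smul]
        exact ((tensorι E F p (n - p) n _).map_smul a _).symm }
  refine mem_of_tensorι_mem S (fun p q h y => ?_) x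
  obtain rfl : q = n - p := by omega
  refine ⟨{p}, fun t ht => ?_⟩
  rw [Finset.sum_eq_single p, tensorProj_tensorι]
  · intro p' _ hne
    rw [tensorProj_tensorι_of_ne _ _ _ _ _ _ (fun h => hne h.1.symm), map_zero]
  · exact fun hp => absurd (ht (Finset.mem_singleton_self p)) hp

lemma tensorProj_eq_zero_of_add_ne (p q n : ℤ) (h : p + q ≠ n) (x : (tensorComplex E F).X n) :
    tensorProj E F p q n x = 0 := by
  refine mem_of_tensorι_mem (LinearMap.ker (tensorProj E F p q n)) (fun p' q' h' y => ?_) x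
  exact tensorProj_tensorι_of_ne _ _ _ _ _ _ (by rintro ⟨rfl, rfl⟩; exact h h') y

lemma tensor_ext {n : ℤ} {x : (tensorComplex E F).X n}
    (h : ∀ p q, p + q = n → tensorProj E F p q n x = 0) : x = 0 := by
  obtain ⟨s, hs⟩ := exists_finset_sum_tensorι x
  rw [hs s subset_rfl]
  exact Finset.sum_eq_zero fun p _ => by rw [h _ _ (by omega), map_zero]

lemma exists_bound_tensorProj {n : ℤ} (x : (tensorComplex E F).X n) :
    ∃ b : ℕ, ∀ p q, b < p.natAbs → tensorProj E F p q n x = 0 := by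
  obtain ⟨s, hs⟩ := exists_finset_sum_tensorι x
  refine ⟨s.sup Int.natAbs, fun p q hp => ?_⟩
  by_cases hpq : p + q = n
  · rw [hs s subset_rfl, map_sum]
    refine Finset.sum_eq_zero fun p' hp' => tensorProj_tensorι_of_ne _ _ _ _ _ _ ?_ _
    rintro ⟨rfl, -⟩
    have := Finset.le_sup (f := Int.natAbs) hp'
    omega
  · exact tensorProj_eq_zero_of_add_ne _ _ _ hpq x

/-- The sign of `d x ⊗ y` in the tensor product of complexes. -/
abbrev signLeft (p q : ℤ) : ℤˣ :=
  ComplexShape.ε₁ (ComplexShape.down ℤ) (ComplexShape.down ℤ) (ComplexShape.down ℤ) (p, q)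

/-- The sign of `x ⊗ d y` in the tensor product of complexes. -/
abbrev signRight (p q : ℤ) : ℤˣ :=
  ComplexShape.ε₂ (ComplexShape.down ℤ) (ComplexShape.down ℤ) (ComplexShape.down ℤ) (p, q)

lemma tensor_d_tensorι (p q n p' q' n' : ℤ) (h : p + q = n) (hp : p' + 1 = p) (hq : q' + 1 = q)
    (hn : n' + 1 = n) (x : Tens R (E.X p) (F.X q)) :
    ((tensorComplex E F).d n n').hom (tensorι E F p q n h x) =
      signLeft p q •
        tensorι E F p' q n' (by omega) (tensMap (E.d p p').hom LinearMap.id x) +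
      signRight p q •
        tensorι E F p q' n' (by omega) (tensMap LinearMap.id (F.d q q').hom x) := by
  have h1 := HomologicalComplex.mapBifunctor.ι_D₁ E F (tensor.{u, v} R) (ComplexShape.down ℤ)
    n n' p q h
  rw [HomologicalComplex.mapBifunctor.d₁_eq E F (tensor.{u, v} R) (ComplexShape.down ℤ) hp q n'
    (show p' + q = n' by omega)] at h1
  have h2 := HomologicalComplex.mapBifunctor.ι_D₂ E F (tensor.{u, v} R) (ComplexShape.down ℤ)
    n n' p q h
  rw [HomologicalComplex.mapBifunctor.d₂_eq E F (tensor.{u, v} R) (ComplexShape.down ℤ) p hq n'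
    (show p + q' = n' by omega)] at h2
  exact congrArg₂ (· + ·) (ConcreteCategory.congr_hom h1 x) (ConcreteCategory.congr_hom h2 x)

lemma tensorProj_d (p q n p' q' n' : ℤ) (hp : p' + 1 = p) (hq : q' + 1 = q)
    (hn : n' + 1 = n) (x : (tensorComplex E F).X n) :
    tensorProj E F p' q' n' (((tensorComplex E F).d n n').hom x) =
      signLeft p q' • tensMap (E.d p p').hom LinearMap.id (tensorProj E F p q' n x) +
      signRight p' q • tensMap LinearMap.id (F.d q q').hom (tensorProj E F p' q n x) := by
  let φ : (tensorComplex E F).X n →ₗ[ℤ] Tens R (E.X p') (F.X q') :=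
    tensorProj E F p' q' n' ∘ₗ ((tensorComplex E F).d n n').hom -
      (signLeft p q' : ℤ) • (tensMap (E.d p p').hom LinearMap.id ∘ₗ tensorProj E F p q' n) -
      (signRight p' q : ℤ) • (tensMap LinearMap.id (F.d q q').hom ∘ₗ tensorProj E F p' q n)
  suffices h : φ x = 0 by
    simp only [φ, LinearMap.sub_apply, LinearMap.smul_apply, LinearMap.comp_apply] at h
    rw [sub_sub, sub_eq_zero] at h
    exact h
  refine mem_of_tensorι_mem (LinearMap.ker φ) (fun i j h y => ?_) x
  simp only [φ, LinearMap.mem_ker, LinearMap.sub_apply, LinearMap.smul_apply,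
    LinearMap.comp_apply]
  rw [tensor_d_tensorι i j n (i - 1) (j - 1) n' h (by omega) (by omega) hn, map_add,
    Units.smul_def, Units.smul_def, map_zsmul, map_zsmul]
  by_cases h1 : i = p ∧ j = q'
  · obtain ⟨rfl, rfl⟩ := h1
    obtain rfl : p' = i - 1 := by omega
    rw [tensorProj_tensorι, tensorProj_tensorι,
      tensorProj_tensorι_of_ne (h := by omega) (hne := by omega),
      tensorProj_tensorι_of_ne (h := by omega) (hne := by omega)]
    simp
  · by_cases h2 : i = p' ∧ j = q
    · obtain ⟨rfl, rfl⟩ := h2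
      obtain rfl : q' = j - 1 := by omega
      rw [tensorProj_tensorι, tensorProj_tensorι,
        tensorProj_tensorι_of_ne (h := by omega) (hne := by omega),
        tensorProj_tensorι_of_ne (h := by omega) (hne := by omega)]
      simp
    · rw [tensorProj_tensorι_of_ne (h := by omega) (hne := by omega),
        tensorProj_tensorι_of_ne (h := by omega) (hne := by omega),
        tensorProj_tensorι_of_ne (h := by omega) (hne := by omega),
        tensorProj_tensorι_of_ne (h := by omega) (hne := by omega)]
      simp

end Total

/-! ### Elimination of components and DG-flatness. -/

section Filtration

/-- The elimination of leading components in a filtered complex. -/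
lemma exists_sub_eq_zero_of_filtration {K₂ K₁ K₀ : Type*} [AddCommGroup K₂] [Module ℤ K₂]
    [AddCommGroup K₁] [Module ℤ K₁] [AddCommGroup K₀] [Module ℤ K₀]
    (d₂ : K₂ →ₗ[ℤ] K₁) (d₁ : K₁ →ₗ[ℤ] K₀) (hdd : ∀ z, d₁ (d₂ z) = 0)
    {A : ℤ → Type*} [∀ p, AddCommGroup (A p)] [∀ p, Module ℤ (A p)] (π : ∀ p, K₁ →ₗ[ℤ] A p)
    -- Since `d₁ (d₂ z) = 0`, a condition on `d₁ y` survives the replacement of `y` by `y - d₂ z`;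
    -- it stands for the vanishing of the relevant components of `d y`.
    (good : K₀ → Prop) (a : ℤ)
    (hex : ∀ p > a, ∀ y, (∀ p' > p, π p' y = 0) → good (d₁ y) →
      ∃ z, π p (d₂ z) = π p y ∧ ∀ p' > p, π p' (d₂ z) = 0)
    (k : ℕ) (y : K₁) (hk : ∀ p > a + k, π p y = 0) (hy : good (d₁ y)) :
    ∃ z, ∀ p > a, π p (y - d₂ z) = 0 := by
  induction k generalizing y with
  | zero => exact ⟨0, fun p hp => by simpa using hk p (by omega)⟩
  | succ k ih =>
    obtain ⟨z, hz, hz'⟩ := hex (a + (k + 1)) (by omega) y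
      (fun p hp => hk p (by push_cast; omega)) hy
    obtain ⟨w, hw⟩ := ih (y - d₂ z) (fun p hp => by
      rw [map_sub, sub_eq_zero]
      obtain rfl | hp' := eq_or_ne p (a + (k + 1))
      · exact hz.symm
      · rw [hk p (by push_cast; omega), hz' p (by omega)]) (by rwa [map_sub, hdd, sub_zero])
    exact ⟨z + w, fun p hp => by rw [map_add, ← sub_sub]; exact hw p hp⟩

variable {R : Type u} [Ring R] {E : ChainComplex (ModuleCat.{v} Rᵐᵒᵖ) ℤ}
  {F : ChainComplex (ModuleCat.{v} R) ℤ}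

lemma tensor_d_d (n n' n'' : ℤ) (z : (tensorComplex E F).X n) :
    ((tensorComplex E F).d n' n'').hom (((tensorComplex E F).d n n').hom z) = 0 :=
  ConcreteCategory.congr_hom ((tensorComplex E F).d_comp_d n n' n'') z

lemma units_smul_smul_self {M : Type*} [AddCommGroup M] (ε : ℤˣ) (x : M) : ε • ε • x = x := by
  rw [smul_smul, Int.units_mul_self, one_smul]

lemma units_smul_zero_add_units_smul_zero {M : Type*} [AddCommGroup M] (ε ε' : ℤˣ) :
    ε • (0 : M) + ε' • (0 : M) = 0 := by
  simp

lemma subsingleton_tens_right {E F : Type v} [AddCommGroup E] [Module Rᵐᵒᵖ E] [AddCommGroup F]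
    [Module R F] [Subsingleton F] : Subsingleton (Tens R E F) := by
  refine subsingleton_of_forall_eq 0 fun t => ?_
  induction t using tens_induction with
  | h x y => rw [Subsingleton.elim y 0, tens, TensorProduct.tmul_zero, map_zero]
  | hzero => rfl
  | hadd a b ha hb => rw [ha, hb, add_zero]

lemma subsingleton_tens_left {E F : Type v} [AddCommGroup E] [Module Rᵐᵒᵖ E] [AddCommGroup F]
    [Module R F] [Subsingleton E] : Subsingleton (Tens R E F) := by
  refine subsingleton_of_forall_eq 0 fun t => ?_
  induction t using tens_induction with
  | h x y => rw [Subsingleton.elim x 0, tens, TensorProduct.zero_tmul, map_zero]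
  | hzero => rfl
  | hadd a b ha hb => rw [ha, hb, add_zero]

/-- Elimination of the components of large first degree, when the complexes `E_p ⊗_R F` are
exact. -/
lemma exists_sub_of_exact_right (n a : ℤ)
    (hex : ∀ p > a, Function.Exact
      (tensMap (LinearMap.id (R := Rᵐᵒᵖ) (M := E.X p)) (F.d (n - p + 1) (n - p)).hom)
      (tensMap (LinearMap.id (R := Rᵐᵒᵖ) (M := E.X p)) (F.d (n - p) (n - p - 1)).hom))
    (y : (tensorComplex E F).X n)
    (hy : ∀ p > a, ∀ q, tensorProj E F p q (n - 1) (((tensorComplex E F).d n (n - 1)).hom y) = 0) :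
    ∃ z : (tensorComplex E F).X (n + 1), ∀ p > a, ∀ q,
      tensorProj E F p q n (y - ((tensorComplex E F).d (n + 1) n).hom z) = 0 := by
  obtain ⟨b, hb⟩ := exists_bound_tensorProj y
  have key := exists_sub_eq_zero_of_filtration ((tensorComplex E F).d (n + 1) n).hom
    ((tensorComplex E F).d n (n - 1)).hom (tensor_d_d _ _ _)
    (fun p => tensorProj E F p (n - p) n)
    (fun x => ∀ p > a, ∀ q, tensorProj E F p q (n - 1) x = 0) a
  obtain ⟨z, hz⟩ := key (by
    intro p hp y h1 h2
    have h3 := h2 p hp (n - p - 1)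
    have h4 := h1 (p + 1) (by omega)
    rw [show n - (p + 1) = n - p - 1 by omega] at h4
    -- The component above `p` is zero, so the condition on `d y` says that the leading component is
    -- a cycle of `E_p ⊗ F`.
    rw [tensorProj_d (p + 1) (n - p) n p (n - p - 1) (n - 1) rfl (by omega) (by omega), h4,
      map_zero, smul_zero, zero_add, smul_eq_zero_iff_eq] at h3
    obtain ⟨w, hw⟩ := (hex p hp _).1 h3
    refine ⟨signRight p (n - p + 1) • tensorι E F p (n - p + 1) (n + 1) (by omega) w, ?_, ?_⟩
    · rw [Units.smul_def, map_zsmul, map_zsmul, ← Units.smul_def,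
        tensorProj_d (p + 1) (n - p + 1) (n + 1) p (n - p) n rfl rfl rfl,
        tensorProj_tensorι_of_ne (hne := by omega) (h := by omega), tensorProj_tensorι,
        map_zero, smul_zero, zero_add, units_smul_smul_self, hw]
    · intro p' hp'
      rw [Units.smul_def, map_zsmul, map_zsmul, ← Units.smul_def,
        tensorProj_d (p' + 1) (n - p' + 1) (n + 1) p' (n - p') n rfl rfl rfl,
        tensorProj_tensorι_of_ne (hne := by omega) (h := by omega),
        tensorProj_tensorι_of_ne (hne := by omega) (h := by omega)]
      simp)
    -- With this starting height, `p > a + k` forces `b < |p|`, where all components of `y` vanish.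
    (b + a.natAbs) y
    (fun p hp => hb p _ (by simp only [Nat.cast_add] at hp; omega)) hy
  refine ⟨z, fun p hp q => ?_⟩
  by_cases hq : p + q = n
  · obtain rfl : q = n - p := by omega
    exact hz p hp
  · exact tensorProj_eq_zero_of_add_ne _ _ _ hq _

/-- Elimination of the components of large second degree, when the complexes `E ⊗_R F_q` are
exact. -/
lemma exists_sub_of_exact_left (n a : ℤ)
    (hex : ∀ q > a, Function.Exact
      (tensMap (E.d (n - q + 1) (n - q)).hom (LinearMap.id (R := R) (M := F.X q)))
      (tensMap (E.d (n - q) (n - q - 1)).hom (LinearMap.id (R := R) (M := F.X q))))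
    (y : (tensorComplex E F).X n)
    (hy : ∀ q > a, ∀ p, tensorProj E F p q (n - 1) (((tensorComplex E F).d n (n - 1)).hom y) = 0) :
    ∃ z : (tensorComplex E F).X (n + 1), ∀ q > a, ∀ p,
      tensorProj E F p q n (y - ((tensorComplex E F).d (n + 1) n).hom z) = 0 := by
  obtain ⟨b, hb⟩ := exists_bound_tensorProj y
  have key := exists_sub_eq_zero_of_filtration ((tensorComplex E F).d (n + 1) n).hom
    ((tensorComplex E F).d n (n - 1)).hom (tensor_d_d _ _ _)
    (fun q => tensorProj E F (n - q) q n)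
    (fun x => ∀ q > a, ∀ p, tensorProj E F p q (n - 1) x = 0) a
  obtain ⟨z, hz⟩ := key (by
    intro q hq y h1 h2
    have h3 := h2 q hq (n - q - 1)
    have h4 := h1 (q + 1) (by omega)
    rw [show n - (q + 1) = n - q - 1 by omega] at h4
    rw [tensorProj_d (n - q) (q + 1) n (n - q - 1) q (n - 1) (by omega) rfl (by omega), h4,
      map_zero, smul_zero, add_zero, smul_eq_zero_iff_eq] at h3
    obtain ⟨w, hw⟩ := (hex q hq _).1 h3
    refine ⟨signLeft (n - q + 1) q • tensorι E F (n - q + 1) q (n + 1) (by omega) w, ?_, ?_⟩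
    · rw [Units.smul_def, map_zsmul, map_zsmul, ← Units.smul_def,
        tensorProj_d (n - q + 1) (q + 1) (n + 1) (n - q) q n rfl rfl rfl,
        tensorProj_tensorι, tensorProj_tensorι_of_ne (hne := by omega) (h := by omega),
        map_zero, smul_zero, add_zero, units_smul_smul_self, hw]
    · intro q' hq'
      rw [Units.smul_def, map_zsmul, map_zsmul, ← Units.smul_def,
        tensorProj_d (n - q' + 1) (q' + 1) (n + 1) (n - q') q' n rfl rfl rfl,
        tensorProj_tensorι_of_ne (hne := by omega) (h := by omega),
        tensorProj_tensorι_of_ne (hne := by omega) (h := by omega)]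
      simp)
    (b + a.natAbs + n.natAbs) y
    (fun q hq => hb (n - q) _ (by simp only [Nat.cast_add] at hq; omega)) hy
  refine ⟨z, fun q hq p => ?_⟩
  by_cases hp : p + q = n
  · obtain rfl : p = n - q := by omega
    exact hz q hq
  · exact tensorProj_eq_zero_of_add_ne _ _ _ hp _

/-- A bounded below complex of flat modules is DG-flat. -/
lemma isDGFlat_of_bounded (hF : ∀ q, IsFlat (F.X q)) (h0 : ∀ q < 0, Subsingleton (F.X q)) :
    IsDGFlat F := by
  refine ⟨hF, fun E hE n => ?_⟩
  rw [exactAt_iff_function_exact _ (i := n + 1) (k := n - 1) rfl (by omega)]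
  intro y
  constructor
  · intro hy
    obtain ⟨z, hz⟩ := exists_sub_of_exact_left (E := E) (F := F) n (-1) (fun q _ =>
      (hF q).tensMap_exact ((exactAt_iff_function_exact E rfl (by omega)).1 (hE (n - q)))) y
      (fun q _ p => by rw [hy, map_zero])
    refine ⟨z, (sub_eq_zero.1 (tensor_ext fun p q hpq => ?_)).symm⟩
    by_cases hq : q > -1
    · exact hz q hq p
    · have := h0 q (by omega)
      have : Subsingleton (Tens R (E.X p) (F.X q)) := subsingleton_tens_right
      exact Subsingleton.elim _ _
  · rintro ⟨z, rfl⟩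
    exact tensor_d_d _ _ _ z

/-- A right module has an augmented projective resolution. -/
lemma exists_augmented_resolution {S : Type u} [Ring S] [Small.{v} S] (E : ModuleCat.{v} S) :
    ∃ P : ChainComplex (ModuleCat.{v} S) ℤ, P.Acyclic ∧ (∀ p ≥ 0, Module.Projective S (P.X p)) ∧
      Nonempty (E ≃ₗ[S] P.X (-1)) ∧ ∀ p < -1, Subsingleton (P.X p) := by
  choose Q hQ q hq using fun E : ModuleCat.{v} S => exists_projective_surjective E
  let K : ModuleCat.{v} S → ModuleCat.{v} S := fun N => ModuleCat.of S (LinearMap.ker (q N))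
  let i : ∀ N, K N →ₗ[S] Q N := fun N => (LinearMap.ker (q N)).subtype
  have hi : ∀ N, SES (i N) (q N) := fun N => SES.ker_subtype (hq N)
  let L : ℕ → ModuleCat.{v} S := Nat.rec E (fun _ N => K N)
  let Z : ℤ → ModuleCat.{v} S := fun
    | Int.ofNat n => L (n + 1)
    | Int.negSucc 0 => E
    | Int.negSucc (_ + 1) => ModuleCat.of S PUnit
  let X : ℤ → ModuleCat.{v} S := fun
    | Int.ofNat n => Q (L n)
    | Int.negSucc 0 => E
    | Int.negSucc (_ + 1) => ModuleCat.of S PUnit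
  let ι : ∀ n, Z n →ₗ[S] X n := fun
    | Int.ofNat n => i (L n)
    | Int.negSucc 0 => LinearMap.id
    | Int.negSucc (_ + 1) => LinearMap.id
  let π : ∀ n, X (n + 1) →ₗ[S] Z n := fun
    | Int.ofNat n => q (L (n + 1))
    | Int.negSucc 0 => q E
    | Int.negSucc (_ + 1) => 0
  have hses : ∀ n, SES (ι (n + 1)) (π n) := fun
    | Int.ofNat n => hi (L (n + 1))
    | Int.negSucc 0 => hi E
    | Int.negSucc 1 => ⟨Function.injective_id, fun x => ⟨fun _ => ⟨x, rfl⟩, fun _ => rfl⟩,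
        fun _ => ⟨0, rfl⟩⟩
    | Int.negSucc (_ + 2) => ⟨Function.injective_id, fun x => ⟨fun _ => ⟨x, rfl⟩, fun _ => rfl⟩,
        fun _ => ⟨0, rfl⟩⟩
  refine ⟨splice hses, splice_acyclic hses, ?_, ⟨LinearEquiv.refl S E⟩, ?_⟩
  · rintro (n | n) hn
    · exact hQ (L n)
    · omega
  · rintro (n | _ | n) hn
    · simp at hn; omega
    · exact absurd hn (lt_irrefl _)
    · exact inferInstanceAs (Subsingleton PUnit)

/-- If `F` is DG-flat and exact in negative degrees, then so is `E ⊗_R F` for every right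
module `E`. -/
lemma IsDGFlat.exact_of_neg [Small.{v} R] (hF : IsDGFlat F) (h0 : ∀ j < 0, F.ExactAt j)
    (E : ModuleCat.{v} Rᵐᵒᵖ) {i j k : ℤ} (hi : j + 1 = i) (hk : k + 1 = j) (hj : j < 0) :
    Function.Exact (tensMap (LinearMap.id (R := Rᵐᵒᵖ) (M := E)) (F.d i j).hom)
      (tensMap (LinearMap.id (R := Rᵐᵒᵖ) (M := E)) (F.d j k).hom) := by
  -- `P` is exact with `E` in degree `-1`, so DG-flatness of `F` makes `P ⊗ F` exact.
  obtain ⟨P, hP, hproj, ⟨e⟩, hsub⟩ := exists_augmented_resolution E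
  suffices h : ∀ x : Tens R (P.X (-1)) (F.X j),
      tensMap LinearMap.id (F.d j k).hom x = 0 →
        ∃ y, tensMap (LinearMap.id (R := Rᵐᵒᵖ) (M := P.X (-1))) (F.d i j).hom y = x by
    intro x
    constructor
    · intro hx
      obtain ⟨y, hy⟩ := h (tensMap e.toLinearMap LinearMap.id x) (by
        rw [← tensMap_comm, hx, map_zero])
      refine ⟨tensMap e.symm.toLinearMap LinearMap.id y, ?_⟩
      rw [← tensMap_comm, hy, tensMap_comp]
      have : e.symm.toLinearMap ∘ₗ e.toLinearMap = LinearMap.id := by ext; simp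
      rw [this]
      exact tensMap_id x
    · rintro ⟨z, rfl⟩
      rw [tensMap_comp, ← ModuleCat.hom_comp, F.d_comp_d, ModuleCat.hom_zero, tensMap_zero_right]
  intro x hx
  -- The only other component of the differential lies over `P_{-2} = 0`.
  have hd : ((tensorComplex P F).d k (k - 1)).hom (tensorι P F (-1) j k (by omega) x) = 0 := by
    have := hsub (-2) (by omega)
    have : Subsingleton (Tens R (P.X (-2)) (F.X j)) := subsingleton_tens_left
    rw [tensor_d_tensorι (-1) j k (-2) k (k - 1) (by omega) rfl hk (by omega), hx,
      Subsingleton.elim (tensMap (P.d (-1) (-2)).hom LinearMap.id x) 0]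
    simp only [map_zero]
    exact units_smul_zero_add_units_smul_zero _ _
  obtain ⟨y, hy⟩ := ((exactAt_iff_function_exact (tensorComplex P F) (i := j) (j := k)
    hk (by omega)).1 (hF.2 P hP k) _).1 hd
  obtain rfl : k = j - 1 := by omega
  -- For `p ≥ 0` the module `P_p` is projective and `F` is exact in degree `j - p < 0`. After the
  -- elimination no term over `P_0` remains, so the boundary equation in position `(-1, j)` involves
  -- only `P_{-1} ⊗ F`.
  obtain ⟨z, hz⟩ := exists_sub_of_exact_right (E := P) (F := F) j (-1) (fun p hp => by
    have := hproj p (by omega)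
    exact tensMap_exact_of_projective ((exactAt_iff_function_exact F rfl (by omega)).1
      (h0 _ (by omega)))) y (fun p hp q => by
        rw [hy, tensorProj_tensorι_of_ne _ _ _ _ _ _ (by omega)])
  have h1 : x = tensorProj P F (-1) j (j - 1) (((tensorComplex P F).d j (j - 1)).hom
      (y - ((tensorComplex P F).d (j + 1) j).hom z)) := by
    rw [map_sub, tensor_d_d, sub_zero, hy, tensorProj_tensorι]
  rw [tensorProj_d 0 i j (-1) j (j - 1) rfl hi (by omega), hz 0 (by omega), map_zero, smul_zero,
    zero_add] at h1
  refine ⟨signRight (-1) i • tensorProj P F (-1) i j (y - ((tensorComplex P F).d (j + 1) j).hom z),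
    ?_⟩
  rw [Units.smul_def, map_zsmul, ← Units.smul_def]
  exact h1.symm

/-- The hypothesis makes the induced map from the cokernel of `f` to `C` injective after every `E ⊗
-`, and such a pure submodule of a flat module is flat. -/
lemma isFlat_of_exact {A B C : ModuleCat.{v} R} {f : A →ₗ[R] B} {g : B →ₗ[R] C} (hC : IsFlat C)
    (h : ∀ E : ModuleCat.{v} Rᵐᵒᵖ, Function.Exact
      (tensMap (LinearMap.id (R := Rᵐᵒᵖ) (M := E)) f)
      (tensMap (LinearMap.id (R := Rᵐᵒᵖ) (M := E)) g)) (hgf : g ∘ₗ f = 0) :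
    IsFlat (ModuleCat.of R (B ⧸ LinearMap.range f)) := by
  let q : B →ₗ[R] ModuleCat.of R (B ⧸ LinearMap.range f) := (LinearMap.range f).mkQ
  let c : ModuleCat.of R (B ⧸ LinearMap.range f) →ₗ[R] C :=
    (LinearMap.range f).liftQ g (by
      rintro _ ⟨x, rfl⟩
      exact LinearMap.congr_fun hgf x)
  have hc : ∀ E : ModuleCat.{v} Rᵐᵒᵖ, TensorInjective E c := by
    intro E
    refine (injective_iff_map_eq_zero _).2 fun t ht => ?_
    obtain ⟨t, rfl⟩ := tensMap_id_surjective (g := q) (Submodule.mkQ_surjective _) t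
    rw [tensMap_id_comp] at ht
    obtain ⟨s, rfl⟩ := (h E t).1 ht
    have : q ∘ₗ f = 0 := LinearMap.ext fun x =>
      (Submodule.Quotient.mk_eq_zero _).2 (LinearMap.mem_range_self f x)
    rw [tensMap_id_comp, this, tensMap_zero_right]
  rw [isFlat_iff]
  intro G G' _ _ _ _ e he a b hab
  apply hc (ModuleCat.of Rᵐᵒᵖ G)
  apply (isFlat_iff C).1 hC e he
  rw [tensMap_comm, hab, tensMap_comm]

/-- If `F` is DG-flat and exact in negative degrees, then its boundaries in degree `-1` form a
flat module. -/
lemma IsDGFlat.isFlat_range [Small.{v} R] (hF : IsDGFlat F) (h0 : ∀ j < 0, F.ExactAt j) :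
    IsFlat (ModuleCat.of R (LinearMap.range (F.d 0 (-1)).hom)) := by
  -- The boundaries are the kernel of `F_{-1} → C_{-1}`, so flatness of `C_{-1}` suffices; it is
  -- pure in `F_{-2}`.
  refine (hF.1 (-1)).ker (SES.mkQ (LinearMap.range (F.d 0 (-1)).hom)) ?_
  refine isFlat_of_exact (f := (F.d 0 (-1)).hom) (g := (F.d (-1) (-2)).hom) (hF.1 (-2))
    (fun E => hF.exact_of_neg h0 E rfl rfl (by omega)) ?_
  rw [← ModuleCat.hom_comp, F.d_comp_d, ModuleCat.hom_zero]

end Filtration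

/-! ### Comparison of resolutions of a module with those of its complex. -/

section Resolutions

variable {R : Type u} [Ring R] {F : ChainComplex (ModuleCat.{v} R) ℤ} {M : ModuleCat.{v} R}

lemma coker_ses {j : ℤ} (h : F.ExactAt (j + 1)) :
    ∃ (f : coker F (j + 1) →ₗ[R] F.X j) (g : F.X j →ₗ[R] coker F j), SES f g := by
  have hex := (exactAt_iff_function_exact F (i := j + 1 + 1) (j := j + 1) (k := j) rfl rfl).1 h
  have hle : LinearMap.range (F.d (j + 1 + 1) (j + 1)).hom ≤ LinearMap.ker (F.d (j + 1) j).hom :=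
    hex.linearMap_ker_eq.ge
  refine ⟨(LinearMap.range (F.d (j + 1 + 1) (j + 1)).hom).liftQ (F.d (j + 1) j).hom hle,
    (LinearMap.range (F.d (j + 1) j).hom).mkQ, ?_, ?_, Submodule.mkQ_surjective _⟩
  · refine (injective_iff_map_eq_zero _).2 fun x hx => ?_
    obtain ⟨x, rfl⟩ := Submodule.mkQ_surjective _ x
    exact (Submodule.Quotient.mk_eq_zero _).2 ((hex x).1 hx)
  · intro x
    refine (Submodule.Quotient.mk_eq_zero _).trans ⟨?_, ?_⟩
    · rintro ⟨y, rfl⟩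
      exact ⟨Submodule.Quotient.mk y, rfl⟩
    · rintro ⟨y, rfl⟩
      obtain ⟨y, rfl⟩ := Submodule.mkQ_surjective _ y
      exact ⟨y, rfl⟩

/-- Cycles modulo boundaries sit inside `F_0` modulo boundaries, and the quotient is the image of
the differential. This links `M ≅ H_0(F)` with `C_0`. -/
lemma homology_ses (F : ChainComplex (ModuleCat.{v} R) ℤ) :
    ∃ (f : F.homology 0 →ₗ[R] coker F 0)
      (g : coker F 0 →ₗ[R] ModuleCat.of R (LinearMap.range (F.d 0 (-1)).hom)), SES f g := by
  let S : ShortComplex (ModuleCat.{v} R) := F.sc' (0 + 1) 0 (-1)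
  have e : F.homology 0 ≃ₗ[R] (LinearMap.ker S.g.hom ⧸ LinearMap.range S.moduleCatToCycles) :=
    ((F.homologyIsoSc' (0 + 1) 0 (-1) (ChainComplex.prev ℤ 0) 
      (ComplexShape.next_eq' _ (show (-1 : ℤ) + 1 = 0 by rfl))) ≪≫
      S.moduleCatHomologyIso).toLinearEquiv
  have hle : LinearMap.range (F.d (0 + 1) 0).hom ≤
      LinearMap.ker (F.d 0 (-1)).hom.rangeRestrict := by
    rintro _ ⟨x, rfl⟩
    exact Subtype.ext (ConcreteCategory.congr_hom (F.d_comp_d (0 + 1) 0 (-1)) x)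
  let f : ModuleCat.of R (LinearMap.ker S.g.hom ⧸ LinearMap.range S.moduleCatToCycles) →ₗ[R]
      coker F 0 := Submodule.mapQ _ (LinearMap.range (F.d (0 + 1) 0).hom)
        (LinearMap.ker S.g.hom).subtype (by
          rintro _ ⟨x, rfl⟩
          exact ⟨x, rfl⟩)
  let g : coker F 0 →ₗ[R] ModuleCat.of R (LinearMap.range (F.d 0 (-1)).hom) :=
    Submodule.liftQ _ (F.d 0 (-1)).hom.rangeRestrict hle
  have h : SES f g := by
    refine ⟨?_, ?_, ?_⟩
    · refine (injective_iff_map_eq_zero _).2 fun x hx => ?_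
      obtain ⟨x, rfl⟩ := Submodule.mkQ_surjective _ x
      obtain ⟨y, hy⟩ := (Submodule.Quotient.mk_eq_zero _).1 hx
      exact (Submodule.Quotient.mk_eq_zero _).2 ⟨y, Subtype.ext hy⟩
    · intro x
      obtain ⟨x, rfl⟩ := Submodule.mkQ_surjective _ x
      constructor
      · intro hx
        exact ⟨Submodule.Quotient.mk ⟨x, congrArg Subtype.val hx⟩, rfl⟩
      · rintro ⟨y, hy⟩
        rw [← hy]
        obtain ⟨y, rfl⟩ := Submodule.mkQ_surjective _ y
        exact Subtype.ext y.2
    · rintro ⟨_, x, rfl⟩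
      exact ⟨Submodule.Quotient.mk x, rfl⟩
  exact ⟨_, g, h.equiv_left e⟩

lemma exactAt_of_quasiIso (φ : F ⟶ inDegreeZero M) [QuasiIso φ] {j : ℤ} (hj : j ≠ 0) :
    F.ExactAt j := by
  rw [exactAt_iff_of_quasiIsoAt φ]
  exact HomologicalComplex.exactAt_single_obj _ _ _ _ hj

lemma exists_homology_equiv (φ : F ⟶ inDegreeZero M) [QuasiIso φ] :
    Nonempty (F.homology 0 ≃ₗ[R] M) :=
  ⟨(isoOfQuasiIsoAt φ 0 ≪≫
    HomologicalComplex.singleObjHomologySelfIso (ComplexShape.down ℤ) 0 M).toLinearEquiv⟩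

/-- The embedding of `ℕ`-indexed chain complexes in `ℤ`-indexed chain complexes. -/
def embeddingNatInt : (ComplexShape.down ℕ).Embedding (ComplexShape.down ℤ) :=
  ComplexShape.Embedding.mk' _ _ (fun n => (n : ℤ)) (fun _ _ h => Int.ofNat.inj h)
    (fun a b => by simp; omega)

lemma exists_projective_resolution [Small.{v} R] (M : ModuleCat.{v} R) :
    ∃ (F : ChainComplex (ModuleCat.{v} R) ℤ) (φ : F ⟶ inDegreeZero M), QuasiIso φ ∧
      (∀ n, Module.Projective R (F.X n)) ∧ ∀ n < 0, Subsingleton (F.X n) := by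
  let P := projectiveResolution M
  have h0 : ∀ n < 0, Subsingleton ((P.complex.extend embeddingNatInt).X n) := fun n hn =>
    ModuleCat.subsingleton_of_isZero
      (P.complex.isZero_extend_X embeddingNatInt n (fun i (hi : (i : ℤ) = n) => by omega))
  refine ⟨P.complex.extend embeddingNatInt, HomologicalComplex.extendMap P.π embeddingNatInt ≫
    (HomologicalComplex.extendSingleIso embeddingNatInt M (i := 0) (i' := 0) rfl).hom,
    ?_, ?_, h0⟩
  · have : QuasiIso (HomologicalComplex.extendMap P.π embeddingNatInt) := inferInstance
    let e := HomologicalComplex.extendSingleIso embeddingNatInt M (i := 0) (i' := 0) rfl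
    have : QuasiIso e.hom := inferInstance
    exact quasiIso_comp _ e.hom
  · intro n
    by_cases hn : n < 0
    · have := h0 n hn
      infer_instance
    · obtain ⟨n, rfl⟩ := Int.eq_ofNat_of_zero_le (not_lt.1 hn)
      have := P.projective n
      exact Module.Projective.of_equiv
        (P.complex.extendXIso embeddingNatInt (i := n) (i' := n) rfl).symm.toLinearEquiv

/-- A complex quasi-isomorphic to a nonzero module in degree zero has nonnegative dimension, and
every bound for it bounds the dimension of the module. -/
lemma ComplexGfdLE.exists_gfDimLE [Small.{v} R] (hR : IsLeftGFClosed.{u, v} R) [Nontrivial M]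
    {g : ℤ} (h : ComplexGfdLE (inDegreeZero M) g) : ∃ n : ℕ, g = n ∧ GFDimLE n M := by
  obtain ⟨F, φ, hF, hφ, hex, hGF⟩ := h
  obtain ⟨e⟩ := exists_homology_equiv φ
  -- For `g < 0` the bound would give `H_0(F) = 0`, contradicting `M ≠ 0`.
  have hg : 0 ≤ g := by
    by_contra! hg
    have := ModuleCat.subsingleton_of_isZero
      ((HomologicalComplex.exactAt_iff_isZero_homology _ _).1 (hex 0 hg))
    exact not_subsingleton M e.symm.injective.subsingleton
  obtain ⟨n, rfl⟩ := Int.eq_ofNat_of_zero_le hg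
  refine ⟨n, rfl, ?_⟩
  have key : ∀ (k : ℕ) (j : ℤ), 0 ≤ j → j + k = n → GFDimLE k (coker F j) := by
    intro k
    induction k with
    | zero => exact fun j _ hj => hGF j (by omega)
    | succ k ih =>
      intro j hj0 hj
      obtain ⟨f, g, h⟩ := coker_ses (exactAt_of_quasiIso φ (j := j + 1) (by omega))
      exact ⟨_, _, f, g, h, (hF.1 j).isGorensteinFlat, ih (j + 1) (by omega) (by omega)⟩
  obtain ⟨f, g, h⟩ := homology_ses F
  exact ((key n 0 le_rfl (by omega)).ker hR h
    (hF.isFlat_range (fun j hj => exactAt_of_quasiIso φ hj.ne)).isGorensteinFlat).of_equiv e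

lemma GFDimLE.complexGfdLE [Small.{v} R] (hR : IsLeftGFClosed.{u, v} R) {n : ℕ}
    (hM : GFDimLE n M) : ComplexGfdLE (inDegreeZero M) n := by
  obtain ⟨F, φ, hφ, hproj, h0⟩ := exists_projective_resolution M
  -- The subtraction is truncated, so for `j ≥ n` this says that `C_j` is Gorenstein flat.
  have hcoker : ∀ j : ℕ, GFDimLE (n - j) (coker F j) := by
    intro j
    induction j with
    | zero =>
      obtain ⟨e⟩ := exists_homology_equiv φ
      obtain ⟨f, g, h⟩ := homology_ses F
      -- As `F_{-1} = 0`, the right end of the homology sequence vanishes and `C_0 ≅ H_0(F) ≅ M`.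
      have := h0 (-1) (by omega)
      refine hM.of_equiv (e.symm.trans (LinearEquiv.ofBijective f ⟨h.inj, fun x => ?_⟩))
      exact (h.exact x).1 (Subsingleton.elim (α := LinearMap.range (F.d 0 (-1)).hom) _ _)
    | succ j ih =>
      obtain ⟨f, g, h⟩ := coker_ses (exactAt_of_quasiIso φ (j := (j : ℤ) + 1) (by omega))
      have := hproj j
      rw [← Nat.sub_sub]
      exact GFDimLE.syzygy hR h ih
  refine ⟨F, φ, isDGFlat_of_bounded (fun q => ?_) h0, hφ,
    fun j hj => exactAt_of_quasiIso φ (by omega), fun j hj => ?_⟩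
  · have := hproj q
    exact isFlat_of_projective _
  · obtain ⟨j, rfl⟩ := Int.eq_ofNat_of_zero_le (show 0 ≤ j by omega)
    have := hcoker j
    rwa [Nat.sub_eq_zero_of_le (by omega)] at this

end Resolutions

end
end GorensteinFlat

/-! ### The equality of dimensions. -/

theorem proposition2 {R : Type u} [Ring R] [Small.{v} R]
    (hR : GorensteinFlat.IsLeftGFClosed.{u, v} R) (M : ModuleCat.{v} R) (hM : Nontrivial M) :
    GorensteinFlat.complexGfd (GorensteinFlat.inDegreeZero M) = GorensteinFlat.moduleGfd M := by
  unfold GorensteinFlat.complexGfd GorensteinFlat.moduleGfd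
  -- The two sets of bounds coincide, so no property of the infimum is needed, even when the sets
  -- are empty.
  congr 1
  ext d
  constructor
  · rintro ⟨g, hg, rfl⟩
    obtain ⟨n, rfl, hn⟩ := hg.exists_gfDimLE hR
    exact ⟨n, hn.hasGFResolution, rfl⟩
  · rintro ⟨n, hn, rfl⟩
    exact ⟨n, hn.gfDimLE.complexGfdLE hR, rfl⟩
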